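/- Let a Lie group $G$, with Lie algebra $\mathfrak g$, act from the left on a smooth manifold $M$, and let $(\mathcal G,\nabla,f)$, $\mathcal G=(Y,P,s)$, be a strongly $G$-equivariant bundle gerbe over $M$ with $G$-invariant connection $\nabla$ and $G$-invariant curving $f$. That is: $\pi:Y\to M$ is a surjective submersion, $P$ is a principal $\mathbb T$-bundle ($\mathbb T=U(1)$) over $Y^{[2]}=Y\times_M Y$, $s$ is a section of $\delta P=\pi_1^*P\otimes\pi_2^*P^{-1}\otimes\pi_3^*P$ over $Y^{[3]}$ with $\delta s=1$ ($\pi_i$ omits the $i$-th factor, $\delta=\sum_i(-1)^{i-1}\pi_i^*$); $\nabla\in\sqrt{-1}A^1(P)$ is a connection on $P$ with $s^*(\delta\nabla)=0$, and $f\in\sqrt{-1}A^2(Y)$ satisfies $\delta f=F(\nabla)$; the $G$-action lifts to $Y$ and to $P$ (by bundle isomorphisms) so that $s,\nabla,f$ are invariant. Assume that the actions of $G$ on $M$ and on $Y$ are free and locally trivial, and that $M/G$ and $Y/G$ are smooth manifolds with smooth quotient maps, so that $q:M\to M/G$ and $Y\to Y/G$ are smooth principal $G$-bundles. Let $\bar{\mathcal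 G}=(Y/G,P/G,\bar s)$ be the quotient bundle gerbe over $M/G$, where $\bar s$ is induced by $s$. Write $X^*$ for the vector field generated by $X\in\mathfrak g$. Fix a smooth map $\lambda:Y\to\mathrm{Hom}(\mathfrak g,\sqrt{-1}\,\mathbb R)$ such that $\langle X|\lambda(y_2)-\lambda(y_1)\rangle=\nabla(p;X^*)$ for all $X\in\mathfrak g$ and all $p\in P$ over $(y_1,y_2)\in Y^{[2]}$, and such that $\langle X|d\lambda\rangle+\iota_{X^*}f=0$ and $\langle X|g^*\lambda\rangle=\langle \mathrm{Ad}_{g^{-1}}X|\lambda\rangle$ for all $X\in\mathfrak g$, $g\in G$. For a connection $\Xi\in A^1(M,\mathfrak g)$ on the principal $G$-bundle $q:M\to M/G$ put $\kappa_\Xi=\langle\pi^*\Xi|\lambda\rangle\in\sqrt{-1}A^1(Y)$. The reduction of $(\mathcal G,\nabla,f)$ with respect to $\lambda$ and $\Xi$ is $(\bar{\mathcal G},\bar\nabla,\bar f)$, where the connection $\bar\nabla$ and the curving $\bar f$ on $\bar{\mathcal G}$ are those to which $\nabla-\delta\kappa_\Xi$ and $f-d\kappa_\Xi$ descend, i.e.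 their pull-backs along $P\to P/G$ and $Y\to Y/G$ are $\nabla-\delta\kappa_\Xi$ and $f-d\kappa_\Xi$. Proposition. For fixed $\lambda$, the stable isomorphism class of the reduction does not depend on $\Xi$: if $(\bar{\mathcal G},\bar\nabla,\bar f)$ and $(\bar{\mathcal G},\bar\nabla',\bar f')$ are the reductions with respect to $\lambda$ and connections $\Xi$ and $\Xi'$ on $q:M\to M/G$, then they are stably isomorphic as bundle gerbes with connection and curving over $M/G$. Here a stable isomorphism from $(\mathcal H,\nabla,f)$ to $(\mathcal H',\nabla',f')$ is a principal $\mathbb T$-bundle $R$ over the fibre product $Z$ of the submersions of $\mathcal H$ and $\mathcal H'$, with a section $v$ over $Z^{[2]}$ of $\delta R^{-1}\otimes P_{\mathcal H}^{-1}\otimes P_{\mathcal H'}$ such that $\delta v=s_{\mathcal H}^{-1}\otimes s_{\mathcal H'}$, and a connection $\eta$ on $R$ with $v^*(\delta\eta^{-1}\otimes\nabla^{-1}\otimes\nabla')=0$ and $F(\eta)=f'-f$. -/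

import Mathlib

open scoped Manifold ContDiff Topology

universe u

noncomputable section

namespace GerbeReduction

/-! ## Manifolds and differential forms -/

/-- A smooth (`C^∞`) Hausdorff manifold without boundary, modelled on a real Banach space.
Finite-dimensional manifolds are the case of a finite-dimensional model. -/
structure Mfd : Type (u + 1) where
  carrier : Type u
  model : Type u
  [normed : NormedAddCommGroup model]
  [normedSpace : NormedSpace ℝ model]
  [complete : CompleteSpace model]
  [top : TopologicalSpace carrier]
  [t2 : T2Space carrier]
  [charted : ChartedSpace model carrier]
  [isManifold : IsManifold 𝓘(ℝ, model) ∞ carrier]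

instance : CoeSort Mfd.{u} (Type u) := ⟨Mfd.carrier⟩

attribute [instance] Mfd.normed Mfd.normedSpace Mfd.complete Mfd.top Mfd.t2 Mfd.charted
  Mfd.isManifold

/-- The model with corners of a manifold (no boundary, no corners). -/
abbrev Mfd.I (M : Mfd.{u}) : ModelWithCorners ℝ M.model M.model := 𝓘(ℝ, M.model)

/-- Smooth maps between manifolds. -/
abbrev IsSmooth {M N : Mfd.{u}} (φ : M → N) : Prop := ContMDiff M.I N.I ∞ φ

/-- The differential `T_x M → T_{φ x} N`. In Mathlib, `TangentSpace M.I x` is by definition the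
model space `M.model`, identified with the tangent space through the preferred chart at `x`. -/
def D {M N : Mfd.{u}} (φ : M → N) (x : M) : M.model →L[ℝ] N.model := mfderiv M.I N.I φ x

/-- The differential `T_x M → F` of a map to a normed space. -/
def dMap {M : Mfd.{u}} {F : Type*} [NormedAddCommGroup F] [NormedSpace ℝ F] (φ : M → F) (x : M) :
    M.model →L[ℝ] F := mfderiv M.I 𝓘(ℝ, F) φ x

/-- The velocity at time `0` of a curve. -/
def vel {M : Mfd.{u}} (c : ℝ → M) : M.model := mfderiv 𝓘(ℝ, ℝ) M.I c 0 (1 : ℝ)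

/-- Germ at time `0` of a smooth curve. -/
abbrev IsCurve {M : Mfd.{u}} (c : ℝ → M) : Prop := ContMDiffAt 𝓘(ℝ, ℝ) M.I ∞ c 0

/-- (Not necessarily smooth) `F`-valued differential `k`-forms on `M`: at each point an alternating
continuous multilinear map on the tangent space. -/
abbrev Form (M : Mfd.{u}) (k : ℕ) (F : Type*) [NormedAddCommGroup F] [NormedSpace ℝ F] :=
  M → M.model [⋀^Fin k]→L[ℝ] F

namespace Form

variable {M N : Mfd.{u}} {k : ℕ} {F : Type*} [NormedAddCommGroup F] [NormedSpace ℝ F]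

/-- Pull-back `φ^* θ`. -/
def pullback (φ : M → N) (θ : Form N k F) : Form M k F :=
  fun x => (θ (φ x)).compContinuousLinearMap (D φ x)

/-- The expression of `θ` in the preferred chart at `x₀`: its pull-back by the inverse chart. It is
meaningful on the target of that chart. -/
def inChart (θ : Form M k F) (x₀ : M) : M.model → M.model [⋀^Fin k]→L[ℝ] F :=
  fun z => (θ ((chartAt M.model x₀).symm z)).compContinuousLinearMap
    (mfderiv 𝓘(ℝ, M.model) M.I (chartAt M.model x₀).symm z : M.model →L[ℝ] M.model)

/-- A form is smooth if all its chart expressions are. -/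
def Smooth (θ : Form M k F) : Prop :=
  ∀ x₀ : M, ContDiffOn ℝ ∞ (θ.inChart x₀) (chartAt M.model x₀).target

/-- The exterior derivative: at `x` it is the exterior derivative of the expression of `θ` in the
preferred chart at `x` (whose differential at `x` is the identification of `T_x M` with the model
space). -/
def d (θ : Form M k F) : Form M (k + 1) F :=
  fun x => extDeriv (θ.inChart x) (chartAt M.model x x)

end Form

/-! ## Group actions and principal bundles

A Lie group `K` is given by Mathlib's type classes, with model space `EK`; `EK` is also the Lie
algebra, i.e. the tangent space at `1`. -/

section Group

variable (K : Type*) {EK : Type*} [NormedAddCommGroup EK] [NormedSpace ℝ EK]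
  [TopologicalSpace K] [ChartedSpace EK K] [Group K]

/-- The value at `x` of the vector field generated by `X` in the Lie algebra:
the derivative at `g = 1` of `g ↦ g • x` in the direction `X`. -/
def infAct {M : Mfd.{u}} [MulAction K M] (X : EK) (x : M) : M.model :=
  mfderiv 𝓘(ℝ, EK) M.I (fun g : K => g • x) 1 X

/-- The adjoint action of `g` on the Lie algebra: the differential at `1` of `h ↦ g h g⁻¹`. -/
def Ad (g : K) : EK →L[ℝ] EK :=
  mfderiv 𝓘(ℝ, EK) 𝓘(ℝ, EK) (fun h : K => g * h * g⁻¹) 1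

/-- `K`-invariant forms. -/
def Form.Invariant {M : Mfd.{u}} [MulAction K M] {k : ℕ} {F : Type*} [NormedAddCommGroup F]
    [NormedSpace ℝ F] (θ : Form M k F) : Prop :=
  ∀ g : K, Form.pullback (fun x : M => g • x) θ = θ

variable (EK) in
/-- `proj : P → N` is a smooth principal `K`-bundle over the submanifold `S` of `N`: `K` acts
smoothly and freely on `P`, the non-empty fibres of `proj` are the orbits and lie exactly over `S`,
and locally over `S` there are a smooth section `σ` and a smooth map `τ` to `K` such that
`p = τ p • σ (proj p)`, so that `(x, k) ↦ k • σ x` is a diffeomorphism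
`(U ∩ S) × K ≅ proj ⁻¹ U` with smooth inverse `p ↦ (proj p, τ p)`. -/
structure IsPrincipalBundle {P : Mfd.{u}} [MulAction K P]
    {EN HN N : Type*} [NormedAddCommGroup EN] [NormedSpace ℝ EN] [TopologicalSpace HN]
    (J : ModelWithCorners ℝ EN HN) [TopologicalSpace N] [ChartedSpace HN N]
    (proj : P → N) (S : Set N) : Prop where
  smooth_smul : ContMDiffSMul 𝓘(ℝ, EK) P.I ∞ K P
  smooth_proj : ContMDiff P.I J ∞ proj
  range_proj : Set.range proj = S
  free : ∀ (k : K) (p : P), k • p = p → k = 1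
  fibre : ∀ p p' : P, proj p = proj p' ↔ ∃ k : K, k • p = p'
  locally_trivial : ∀ x ∈ S, ∃ U : Set N, IsOpen U ∧ x ∈ U ∧ ∃ (σ : N → P) (τ : P → K),
    ContMDiffOn J P.I ∞ σ (U ∩ S) ∧ ContMDiffOn P.I 𝓘(ℝ, EK) ∞ τ (proj ⁻¹' U) ∧
    ∀ p : P, proj p ∈ U → τ p • σ (proj p) = p

variable (EK) in
/-- `q : M → B` is the projection onto the quotient manifold `M / K` of a free and locally trivial
action, i.e. a smooth principal `K`-bundle. -/
def IsQuotient {M B : Mfd.{u}} [MulAction K M] (q : M → B) : Prop :=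
  IsPrincipalBundle K EK B.I q Set.univ

/-- A (principal) connection on the principal `K`-bundle `M → M / K` with left action: a smooth
Lie-algebra-valued 1-form `Ξ` with `Ξ(X^*) = X` and `g^* Ξ = Ad_g Ξ`. -/
structure IsPrincipalConnection {M : Mfd.{u}} [MulAction K M] (Ξ : Form M 1 EK) : Prop where
  smooth : Ξ.Smooth
  vertical : ∀ (X : EK) (x : M), Ξ x ![infAct K X x] = X
  equivariant : ∀ (g : K) (x : M) (w : M.model),
    Form.pullback (fun y : M => g • y) Ξ x ![w] = Ad K g (Ξ x ![w])

end Group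

/-! ## Principal `𝕋`-bundles with connection

`𝕋` is `Circle`. Throughout, an imaginary-valued form `√-1 θ` is represented by the real form `θ`;
so a connection `∇` is represented by the real 1-form `A` with `∇ = √-1 A`, and a curving likewise.
-/

/-- The vector field on `P` that generates the circle action: the velocity of `t ↦ e^{it} p`. -/
def circleField {P : Mfd.{u}} [MulAction Circle P] (p : P) : P.model :=
  vel (fun t : ℝ => Circle.exp t • p)

/-- `√-1 A` is a connection on the principal `𝕋`-bundle `P`: `A` is smooth, `𝕋`-invariant and
normalised on the generator of the action. The curvature `F` of `√-1 A` is the 2-form on the base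
whose pull-back to `P` is `√-1 dA`. -/
structure IsCircleConnection {P : Mfd.{u}} [MulAction Circle P] (A : Form P 1 ℝ) : Prop where
  smooth : A.Smooth
  vertical : ∀ p : P, A p ![circleField p] = 1
  invariant : A.Invariant Circle

/-! ## Bundle gerbes

Let `P₁, …, P_k` be principal `𝕋`-bundles over `X`. A section of the `𝕋`-bundle
`P₁^{ε₁} ⊗ ⋯ ⊗ P_k^{ε_k}` (with `ε_i = ±1`) is described by the function `u` on the fibre product
of the `P_i` over `X` with values in `𝕋` such that the section at `x` is
`u(p₁, …, p_k) · p₁^{ε₁} ⊗ ⋯ ⊗ p_k^{ε_k}` for all `p_i` over `x`. Sections are thus the smooth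
functions `u` with `u(z₁ p₁, …, z_k p_k) = z₁^{-ε₁} ⋯ z_k^{-ε_k} u(p₁, …, p_k)`. If `√-1 A_i` are
connections on the `P_i`, then the pull-back along the section of the induced connection on the
tensor product is, on the fibre product of the `P_i`, the 1-form `u⁻¹ du + √-1 ∑ ε_i A_i`. -/

/-- A bundle gerbe `(Y, P, s)` over `M`. -/
structure BundleGerbe (M : Mfd.{u}) : Type (u + 1) where
  Y : Mfd.{u}
  π : Y → M
  π_submersion : Manifold.IsSubmersion Y.I M.I ∞ π
  π_surjective : Function.Surjective π
  /-- The total space of the `𝕋`-bundle over the fibre product `Y^{[2]} ⊆ Y × Y`. -/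
  P : Mfd.{u}
  [actP : MulAction Circle P]
  proj : P → Y × Y
  principal : IsPrincipalBundle Circle (EuclideanSpace ℝ (Fin 1)) (Y.I.prod Y.I) proj
    {y | π y.1 = π y.2}
  /-- The section of `δP = π₁^* P ⊗ π₂^* P^{-1} ⊗ π₃^* P` over `Y^{[3]}`, as a function of points
  `p₂₃, p₁₃, p₁₂` of `P` over `(y₂, y₃)`, `(y₁, y₃)`, `(y₁, y₂)`; its values at other triples are
  irrelevant. -/
  s : P → P → P → Circle
  s_smooth : ContMDiffOn (P.I.prod (P.I.prod P.I)) (𝓡 1) ∞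
    (fun p : P × P × P => s p.1 p.2.1 p.2.2)
    {p | ∃ y₁ y₂ y₃ : Y, proj p.1 = (y₂, y₃) ∧ proj p.2.1 = (y₁, y₃) ∧ proj p.2.2 = (y₁, y₂)}
  s_equivariant : ∀ (y₁ y₂ y₃ : Y) (p₂₃ p₁₃ p₁₂ : P),
    proj p₂₃ = (y₂, y₃) → proj p₁₃ = (y₁, y₃) → proj p₁₂ = (y₁, y₂) → ∀ a b c : Circle,
      s (a • p₂₃) (b • p₁₃) (c • p₁₂) = a⁻¹ * b * c⁻¹ * s p₂₃ p₁₃ p₁₂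
  /-- `δs = 1` over `Y^{[4]}`. -/
  δs : ∀ (y₁ y₂ y₃ y₄ : Y) (p₁₂ p₁₃ p₁₄ p₂₃ p₂₄ p₃₄ : P),
    proj p₁₂ = (y₁, y₂) → proj p₁₃ = (y₁, y₃) → proj p₁₄ = (y₁, y₄) →
    proj p₂₃ = (y₂, y₃) → proj p₂₄ = (y₂, y₄) → proj p₃₄ = (y₃, y₄) →
      s p₃₄ p₂₄ p₂₃ * (s p₃₄ p₁₄ p₁₃)⁻¹ * s p₂₄ p₁₄ p₁₂ * (s p₂₃ p₁₃ p₁₂)⁻¹ = 1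

attribute [instance] BundleGerbe.actP

namespace BundleGerbe

variable {M : Mfd.{u}} (𝒢 : BundleGerbe M)

/-- `p₂₃, p₁₃, p₁₂` lie over the three pairs taken from one point `(y₁, y₂, y₃)` of `Y^{[3]}`. -/
def IsTriple (p₂₃ p₁₃ p₁₂ : 𝒢.P) : Prop :=
  ∃ y₁ y₂ y₃ : 𝒢.Y, 𝒢.proj p₂₃ = (y₂, y₃) ∧ 𝒢.proj p₁₃ = (y₁, y₃) ∧ 𝒢.proj p₁₂ = (y₁, y₂)

/-- The composite of `P → Y^{[2]}` with the projection `(y₁, y₂) ↦ y₁`. -/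
def pr₁ (p : 𝒢.P) : 𝒢.Y := (𝒢.proj p).1

/-- The composite of `P → Y^{[2]}` with the projection `(y₁, y₂) ↦ y₂`. -/
def pr₂ (p : 𝒢.P) : 𝒢.Y := (𝒢.proj p).2

/-- The pull-back to `P` of `δθ = π₁^* θ - π₂^* θ` on `Y^{[2]}`, where `π_i` omits the `i`-th
factor. Pull-back along the principal bundle `P → Y^{[2]}` is injective on forms. -/
def δ {k : ℕ} (θ : Form 𝒢.Y k ℝ) : Form 𝒢.P k ℝ :=
  Form.pullback 𝒢.pr₂ θ - Form.pullback 𝒢.pr₁ θ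

/-- `√-1 A` is a bundle gerbe connection: a connection on `P` with `s^*(δ∇) = 0`. The vanishing of
this 1-form is tested on the velocities of all curves in the fibre product of the three copies of
`P` over `Y^{[3]}`. -/
structure IsConnection (A : Form 𝒢.P 1 ℝ) : Prop where
  isCircleConnection : IsCircleConnection A
  s_flat : ∀ c₂₃ c₁₃ c₁₂ : ℝ → 𝒢.P, IsCurve c₂₃ → IsCurve c₁₃ → IsCurve c₁₂ →
    (∀ᶠ t in 𝓝 0, 𝒢.IsTriple (c₂₃ t) (c₁₃ t) (c₁₂ t)) →
    HasDerivAt (fun t : ℝ => (𝒢.s (c₂₃ t) (c₁₃ t) (c₁₂ t) : ℂ))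
      (-(Complex.I * ((A (c₂₃ 0) ![vel c₂₃] - A (c₁₃ 0) ![vel c₁₃] + A (c₁₂ 0) ![vel c₁₂] : ℝ) : ℂ))
        * (𝒢.s (c₂₃ 0) (c₁₃ 0) (c₁₂ 0) : ℂ)) 0

/-- `√-1 f` is a curving for the connection `√-1 A`: a smooth 2-form on `Y` with `δf = F(∇)`
(an identity of forms on `Y^{[2]}`, pulled back to `P`). -/
structure IsCurving (A : Form 𝒢.P 1 ℝ) (f : Form 𝒢.Y 2 ℝ) : Prop where
  smooth : f.Smooth
  δ_eq : 𝒢.δ f = A.d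

/-- A connection and a curving for it on the bundle gerbe `𝒢`. -/
structure ConnectionCurving where
  A : Form 𝒢.P 1 ℝ
  f : Form 𝒢.Y 2 ℝ
  isConnection : 𝒢.IsConnection A
  isCurving : 𝒢.IsCurving A f

end BundleGerbe

/-! ## Stable isomorphisms -/

/-- A stable isomorphism from `(𝒢, ∇, f)` to `(𝒢', ∇', f')`: a pseudo `𝕋`-bundle `(R, v)` with
connection `η = √-1 B` for `(𝒢, ∇, f)^{-1} ⊗ (𝒢', ∇', f')` such that `F(η) = f' - f`.

Here `𝒢^{-1} ⊗ 𝒢'` is the bundle gerbe over `M` whose surjective submersion is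
`Z = Y ×_M Y' → M`, whose `𝕋`-bundle over `Z^{[2]}` has the fibre
`P_{(y₁, y₂)}^{-1} ⊗ P'_{(y₁', y₂')}` over `(z₁, z₂)`, `z_i = (y_i, y_i')`, and whose section is
`s^{-1} ⊗ s'`. So `R` is a principal `𝕋`-bundle over `Z`, and `v` is a section over `Z^{[2]}` of
`δR^{-1} ⊗ (P^{-1} ⊗ P') = R_{z₂}^{-1} ⊗ R_{z₁} ⊗ P_{(y₁, y₂)}^{-1} ⊗ P'_{(y₁', y₂')}`
with `δv = s^{-1} ⊗ s'` and `v^*(δη^{-1} ⊗ ∇^{-1} ⊗ ∇') = 0`. -/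
structure StableIsomorphism {M : Mfd.{u}} {𝒢 𝒢' : BundleGerbe M}
    (C : 𝒢.ConnectionCurving) (C' : 𝒢'.ConnectionCurving) : Type (u + 1) where
  R : Mfd.{u}
  [actR : MulAction Circle R]
  proj : R → 𝒢.Y × 𝒢'.Y
  principal : IsPrincipalBundle Circle (EuclideanSpace ℝ (Fin 1)) (𝒢.Y.I.prod 𝒢'.Y.I) proj
    {z | 𝒢.π z.1 = 𝒢'.π z.2}
  /-- The section `v`, as a function of points `r₂, r₁, p, p'` over
  `z₂`, `z₁`, `(y₁, y₂)`, `(y₁', y₂')`. -/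
  v : R → R → 𝒢.P → 𝒢'.P → Circle
  v_smooth : ContMDiffOn (R.I.prod (R.I.prod (𝒢.P.I.prod 𝒢'.P.I))) (𝓡 1) ∞
    (fun w : R × R × 𝒢.P × 𝒢'.P => v w.1 w.2.1 w.2.2.1 w.2.2.2)
    {w | 𝒢.proj w.2.2.1 = ((proj w.2.1).1, (proj w.1).1) ∧
      𝒢'.proj w.2.2.2 = ((proj w.2.1).2, (proj w.1).2)}
  v_equivariant : ∀ (r₂ r₁ : R) (p : 𝒢.P) (p' : 𝒢'.P),
    𝒢.proj p = ((proj r₁).1, (proj r₂).1) → 𝒢'.proj p' = ((proj r₁).2, (proj r₂).2) →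
    ∀ a b c e : Circle,
      v (a • r₂) (b • r₁) (c • p) (e • p') = a * b⁻¹ * c * e⁻¹ * v r₂ r₁ p p'
  /-- `δv = s^{-1} ⊗ s'` over `Z^{[3]}`. -/
  δv : ∀ (r₁ r₂ r₃ : R) (p₁₂ p₁₃ p₂₃ : 𝒢.P) (p₁₂' p₁₃' p₂₃' : 𝒢'.P),
    𝒢.proj p₁₂ = ((proj r₁).1, (proj r₂).1) → 𝒢.proj p₁₃ = ((proj r₁).1, (proj r₃).1) →
    𝒢.proj p₂₃ = ((proj r₂).1, (proj r₃).1) →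
    𝒢'.proj p₁₂' = ((proj r₁).2, (proj r₂).2) → 𝒢'.proj p₁₃' = ((proj r₁).2, (proj r₃).2) →
    𝒢'.proj p₂₃' = ((proj r₂).2, (proj r₃).2) →
      v r₃ r₂ p₂₃ p₂₃' * (v r₃ r₁ p₁₃ p₁₃')⁻¹ * v r₂ r₁ p₁₂ p₁₂' =
        (𝒢.s p₂₃ p₁₃ p₁₂)⁻¹ * 𝒢'.s p₂₃' p₁₃' p₁₂'
  B : Form R 1 ℝ
  isCircleConnection : IsCircleConnection B
  v_flat : ∀ (c₂ c₁ : ℝ → R) (b : ℝ → 𝒢.P) (b' : ℝ → 𝒢'.P),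
    IsCurve c₂ → IsCurve c₁ → IsCurve b → IsCurve b' →
    (∀ᶠ t in 𝓝 0, 𝒢.proj (b t) = ((proj (c₁ t)).1, (proj (c₂ t)).1) ∧
      𝒢'.proj (b' t) = ((proj (c₁ t)).2, (proj (c₂ t)).2)) →
    HasDerivAt (fun t : ℝ => (v (c₂ t) (c₁ t) (b t) (b' t) : ℂ))
      (-(Complex.I * ((-(B (c₂ 0) ![vel c₂]) + B (c₁ 0) ![vel c₁]
          - C.A (b 0) ![vel b] + C'.A (b' 0) ![vel b'] : ℝ) : ℂ))
        * (v (c₂ 0) (c₁ 0) (b 0) (b' 0) : ℂ)) 0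
  /-- `F(η) = f' - f` as forms on `Z`, pulled back to `R`. -/
  curvature : B.d = Form.pullback (fun r => (proj r).2) C'.f
    - Form.pullback (fun r => (proj r).1) C.f

/-- `(𝒢, ∇, f)` and `(𝒢', ∇', f')` are stably isomorphic. -/
def StablyIsomorphic {M : Mfd.{u}} {𝒢 𝒢' : BundleGerbe M}
    (C : 𝒢.ConnectionCurving) (C' : 𝒢'.ConnectionCurving) : Prop :=
  Nonempty (StableIsomorphism C C')

/-! ## Strongly equivariant bundle gerbes and their reduction -/

section Equivariant

variable (G : Type*) {EG : Type*} [NormedAddCommGroup EG] [NormedSpace ℝ EG]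
  [TopologicalSpace G] [ChartedSpace EG G] [Group G]

variable (EG) in
/-- `𝒢 = (Y, P, s)` is strongly `G`-equivariant for the given actions of `G` on `M`, `Y` and `P`:
they are smooth and compatible with the projections, `G` acts on `P` by bundle isomorphisms, and
the section `s` is invariant. -/
structure IsStronglyEquivariant {M : Mfd.{u}} [MulAction G M] (𝒢 : BundleGerbe M)
    [MulAction G 𝒢.Y] [MulAction G 𝒢.P] : Prop where
  smooth_base : ContMDiffSMul 𝓘(ℝ, EG) M.I ∞ G M
  smooth_Y : ContMDiffSMul 𝓘(ℝ, EG) 𝒢.Y.I ∞ G 𝒢.Y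
  smooth_P : ContMDiffSMul 𝓘(ℝ, EG) 𝒢.P.I ∞ G 𝒢.P
  π_smul : ∀ (g : G) (y : 𝒢.Y), 𝒢.π (g • y) = g • 𝒢.π y
  proj_smul : ∀ (g : G) (p : 𝒢.P), 𝒢.proj (g • p) = (g • (𝒢.proj p).1, g • (𝒢.proj p).2)
  smul_comm : ∀ (g : G) (z : Circle) (p : 𝒢.P), g • z • p = z • g • p
  s_smul : ∀ (g : G) (p₂₃ p₁₃ p₁₂ : 𝒢.P), 𝒢.IsTriple p₂₃ p₁₃ p₁₂ →
    𝒢.s (g • p₂₃) (g • p₁₃) (g • p₁₂) = 𝒢.s p₂₃ p₁₃ p₁₂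

variable {M : Mfd.{u}} {𝒢 : BundleGerbe M}

/-- The pull-back `π^* E` to `Y` of the first component of the obstruction cocycle `(E, ζ)`:
`⟨X | π^*E⟩ = (1 / 2π√-1) (⟨X | dλ⟩ + ι_{X^*} f)`. Here `λ` and `f` are real representatives of
imaginary objects, so `√-1` cancels. -/
def obstructionE [MulAction G 𝒢.Y] (lam : 𝒢.Y → (EG →L[ℝ] ℝ)) (f : Form 𝒢.Y 2 ℝ)
    (X : EG) (y : 𝒢.Y) (w : 𝒢.Y.model) : ℝ :=
  (1 / (2 * Real.pi)) * (dMap lam y w X + f y ![infAct G X y, w])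

/-- The pull-back `π^* ζ(g)` to `Y` of the second component of `(E, ζ)`:
`⟨X | π^*ζ(g)⟩ = (1 / 2π√-1) ⟨X | g^*λ - Ad_g λ⟩`, where `⟨X | Ad_g λ⟩ = ⟨Ad_{g⁻¹} X | λ⟩`. -/
def obstructionζ [MulAction G 𝒢.Y] (lam : 𝒢.Y → (EG →L[ℝ] ℝ)) (g : G) (X : EG) (y : 𝒢.Y) : ℝ :=
  (1 / (2 * Real.pi)) * (lam (g • y) X - lam y (Ad G g⁻¹ X))

/-- The admissible choices of `λ : Y → Hom(𝔤, √-1 ℝ)` (represented by `lam` with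
`λ = √-1 lam`): smooth, with `δλ` the moment of `(P, ∇)`, i.e.
`⟨X | λ(y₂) - λ(y₁)⟩ = ∇(p; X^*)` for `p` over `(y₁, y₂)`, and with `(E, ζ) = 0`. Since `π^*` is
injective on forms, the vanishing may be expressed on `Y`. -/
structure IsAdmissible [MulAction G 𝒢.Y] [MulAction G 𝒢.P]
    (C : 𝒢.ConnectionCurving) (lam : 𝒢.Y → (EG →L[ℝ] ℝ)) : Prop where
  smooth : ContMDiff 𝒢.Y.I 𝓘(ℝ, EG →L[ℝ] ℝ) ∞ lam
  δ_eq_moment : ∀ (X : EG) (p : 𝒢.P),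
    lam (𝒢.pr₂ p) X - lam (𝒢.pr₁ p) X = C.A p ![infAct G X p]
  E_eq_zero : ∀ (X : EG) (y : 𝒢.Y) (w : 𝒢.Y.model), obstructionE G lam C.f X y w = 0
  ζ_eq_zero : ∀ (g : G) (X : EG) (y : 𝒢.Y), obstructionζ G lam g X y = 0

/-- The 1-form `κ = ⟨π^*Ξ | λ⟩` on `Y`. -/
def kappa (Ξ : Form M 1 EG) (lam : 𝒢.Y → (EG →L[ℝ] ℝ)) : Form 𝒢.Y 1 ℝ :=
  fun y => (lam y).compContinuousAlternatingMap (Form.pullback 𝒢.π Ξ y)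

variable (EG) in
/-- The bundle gerbe `𝒢bar = (Y / G, P / G, sbar)` over `M / G`, with the quotient maps
`q : M → M / G`, `qY : Y → Y / G`, `qP : P → P / G`: the projections and the circle action are
the induced ones, and `sbar` corresponds to the invariant section `s`. -/
structure IsQuotientGerbe (𝒢 : BundleGerbe M) [MulAction G 𝒢.Y] [MulAction G 𝒢.P]
    {B : Mfd.{u}} (q : M → B) (𝒢bar : BundleGerbe B) (qY : 𝒢.Y → 𝒢bar.Y) (qP : 𝒢.P → 𝒢bar.P) :
    Prop where
  quotient_Y : IsQuotient G EG qY
  quotient_P : IsQuotient G EG qP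
  π_comm : ∀ y : 𝒢.Y, 𝒢bar.π (qY y) = q (𝒢.π y)
  proj_comm : ∀ p : 𝒢.P, 𝒢bar.proj (qP p) = (qY (𝒢.proj p).1, qY (𝒢.proj p).2)
  qP_smul : ∀ (z : Circle) (p : 𝒢.P), qP (z • p) = z • qP p
  s_comm : ∀ p₂₃ p₁₃ p₁₂ : 𝒢.P, 𝒢.IsTriple p₂₃ p₁₃ p₁₂ →
    𝒢bar.s (qP p₂₃) (qP p₁₃) (qP p₁₂) = 𝒢.s p₂₃ p₁₃ p₁₂

/-- `Cbar = (∇bar, fbar)` is the connection and curving on the quotient gerbe to which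
`(∇ - δκ, f - dκ)` descends, where `κ = ⟨π^*Ξ | λ⟩`. The pull-back maps along `qP` and `qY` are
injective, so `Cbar` is determined by this. -/
structure IsReduction (C : 𝒢.ConnectionCurving) (lam : 𝒢.Y → (EG →L[ℝ] ℝ)) (Ξ : Form M 1 EG)
    {B : Mfd.{u}} {𝒢bar : BundleGerbe B} (qY : 𝒢.Y → 𝒢bar.Y) (qP : 𝒢.P → 𝒢bar.P)
    (Cbar : 𝒢bar.ConnectionCurving) : Prop where
  connection : Form.pullback qP Cbar.A = C.A - 𝒢.δ (kappa Ξ lam)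
  curving : Form.pullback qY Cbar.f = C.f - (kappa Ξ lam).d

end Equivariant

end GerbeReduction

end

/-! Two connections on `M → M / G` differ by an `Ad`-equivariant form `Ξ' - Ξ` that vanishes on the
generated vector fields. Pairing its pull-back with the equivariant function `λ` gives `κ_Ξ' - κ_Ξ`,
which is therefore an invariant horizontal 1-form on `Y` and descends to a 1-form `ε` on `Y / G`
(`exists_descent`). Pull-back along the quotient maps is injective (`pullback_injective`) and
commutes with `d` and `δ`, so the second reduction is obtained from the first by `∇bar' = ∇bar - δε`
and `fbar' = fbar - dε`.

It remains to see that such a shift does not change the stable isomorphism class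
(`stablyIsomorphic_of_shift`). Both gerbes have the same `(Y, P, s)`, so `Z = Y^{[2]}` and one takes
`R = P`. The section `v` is the canonical one built from two values of `s` (`transition`); its
cocycle identity follows from `δs = 1`, and its flatness for the unshifted connection from `s^*(δ∇)
= 0`. With `η = ∇ - pr₂^* ε`, the corrections by `ε` cancel in the flatness condition, and the
curvature is `δf - pr₂^* dε = pr₂^* f' - pr₁^* f`. -/

noncomputable section
namespace GerbeReduction

/-! ### Differentials and velocities of curves. -/

section Differential

variable {L M N : Mfd.{u}} {F : Type*} [NormedAddCommGroup F] [NormedSpace ℝ F]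

theorem D_comp {ψ : M → N} {φ : L → M} {x : L}
    (hψ : MDifferentiableAt M.I N.I ψ (φ x)) (hφ : MDifferentiableAt L.I M.I φ x) :
    D (ψ ∘ φ) x = (D ψ (φ x)).comp (D φ x) :=
  mfderiv_comp x hψ hφ

theorem D_id (x : M) : D (fun y : M => y) x = ContinuousLinearMap.id ℝ M.model :=
  mfderiv_id

theorem D_congr {φ ψ : M → N} {x : M} (h : φ =ᶠ[𝓝 x] ψ) : D φ x = D ψ x :=
  h.mfderiv_eq

theorem vel_comp {φ : M → N} {c : ℝ → M} (hφ : MDifferentiableAt M.I N.I φ (c 0))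
    (hc : MDifferentiableAt 𝓘(ℝ, ℝ) M.I c 0) : vel (fun t => φ (c t)) = D φ (c 0) (vel c) := by
  have := mfderiv_comp (0 : ℝ) hφ hc
  exact congrArg (fun T : ℝ →L[ℝ] N.model => T 1) this

theorem vel_congr {c c' : ℝ → M} (h : c =ᶠ[𝓝 0] c') : vel c = vel c' := by
  have := h.mfderiv_eq (I := 𝓘(ℝ, ℝ)) (I' := M.I)
  exact congrArg (fun T : ℝ →L[ℝ] M.model => T 1) this

theorem vel_const (x : M) : vel (fun _ : ℝ => x) = 0 := by
  have := mfderiv_const (I := 𝓘(ℝ, ℝ)) (I' := M.I) (c := x) (x := (0 : ℝ))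
  exact congrArg (fun T : ℝ →L[ℝ] M.model => T 1) this

end Differential

/-! ### Forms in charts: smoothness, pull-back and exterior derivative. -/

namespace Form

variable {L M N : Mfd.{u}} {k : ℕ} {F : Type*} [NormedAddCommGroup F] [NormedSpace ℝ F]

theorem pullback_apply (φ : M → N) (θ : Form N k F) (x : M) (w : Fin k → M.model) :
    pullback φ θ x w = θ (φ x) (fun i => D φ x (w i)) := rfl

theorem pullback_apply_one (φ : M → N) (θ : Form N 1 F) (x : M) (w : M.model) :
    pullback φ θ x ![w] = θ (φ x) ![D φ x w] := by
  rw [pullback_apply]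
  congr 1
  ext i
  fin_cases i
  rfl

theorem ext_one {θ θ' : Form M 1 F} (h : ∀ x w, θ x ![w] = θ' x ![w]) : θ = θ' := by
  funext x
  ext w
  rw [show w = ![w 0] from List.ofFn_inj.mp rfl]
  exact h x _

theorem pullback_sub (φ : M → N) (θ θ' : Form N k F) :
    pullback φ (θ - θ') = pullback φ θ - pullback φ θ' := rfl

theorem pullback_comp {ψ : M → N} {φ : L → M} (hψ : MDifferentiable M.I N.I ψ)
    (hφ : MDifferentiable L.I M.I φ) (θ : Form N k F) :
    pullback φ (pullback ψ θ) = pullback (ψ ∘ φ) θ := by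
  funext x
  ext w
  rw [pullback_apply, pullback_apply, pullback_apply, D_comp (hψ _) (hφ _)]
  rfl

theorem inChart_congr {θ θ' : Form M k F} {x₀ : M} {z : M.model}
    (hz : z ∈ (chartAt M.model x₀).target)
    (h : ∀ᶠ y in 𝓝 ((chartAt M.model x₀).symm z), θ y = θ' y) :
    θ.inChart x₀ =ᶠ[𝓝 z] θ'.inChart x₀ := by
  filter_upwards [((chartAt M.model x₀).continuousAt_symm hz).eventually h] with z' hz'
  simp only [inChart, hz']

theorem smooth_iff {θ : Form M k F} : θ.Smooth ↔ ∀ x₀ : M,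
    ∀ z ∈ (chartAt M.model x₀).target, ContDiffAt ℝ ∞ (θ.inChart x₀) z :=
  forall_congr' fun x₀ => (chartAt M.model x₀).open_target.contDiffOn_iff.trans Iff.rfl

theorem Smooth.contDiffAt {θ : Form M k F} (h : θ.Smooth) {x₀ : M} {z : M.model}
    (hz : z ∈ (chartAt M.model x₀).target) : ContDiffAt ℝ ∞ (θ.inChart x₀) z :=
  smooth_iff.1 h x₀ z hz

theorem Smooth.sub {θ θ' : Form M k F} (h : θ.Smooth) (h' : θ'.Smooth) : (θ - θ').Smooth :=
  fun x₀ => (h x₀).sub (h' x₀)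

theorem contMDiffAt_chart_symm {x₀ : M} {z : M.model} (hz : z ∈ (chartAt M.model x₀).target) :
    ContMDiffAt 𝓘(ℝ, M.model) M.I ∞ (chartAt M.model x₀).symm z :=
  (contMDiffOn_chart_symm (I := M.I) (n := ∞)).contMDiffAt
    ((chartAt M.model x₀).open_target.mem_nhds hz)

theorem contMDiffAt_chart {x₀ x : M} (hx : x ∈ (chartAt M.model x₀).source) :
    ContMDiffAt M.I 𝓘(ℝ, M.model) ∞ (chartAt M.model x₀) x :=
  (contMDiffOn_chart (I := M.I) (n := ∞)).contMDiffAt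
    ((chartAt M.model x₀).open_source.mem_nhds hx)

/-- The expression of a map in the preferred charts at `x₀` and `y₀`. -/
def localRep (φ : M → N) (x₀ : M) (y₀ : N) : M.model → N.model :=
  fun z => chartAt N.model y₀ (φ ((chartAt M.model x₀).symm z))

section Local

variable {φ : M → N} {x₀ : M} {y₀ : N} {z : M.model}

theorem contDiffAt_localRep {n : ℕ∞} (hz : z ∈ (chartAt M.model x₀).target)
    (hφ : ContMDiffAt M.I N.I n φ ((chartAt M.model x₀).symm z))
    (hy : φ ((chartAt M.model x₀).symm z) ∈ (chartAt N.model y₀).source) :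
    ContDiffAt ℝ n (localRep φ x₀ y₀) z := by
  rw [← contMDiffAt_iff_contDiffAt]
  have hn : (n : ℕ∞ω) ≤ ∞ := by exact_mod_cast le_top
  exact ((contMDiffAt_chart hy).of_le hn).comp z
    (hφ.comp z ((contMDiffAt_chart_symm hz).of_le hn))

/-- By the chain rule both sides are the derivative at `z` of `φ ∘ (chartAt M.model x₀).symm`. -/
theorem mfderiv_chart_symm_comp_fderiv_localRep (hz : z ∈ (chartAt M.model x₀).target)
    (hφ : ContMDiffAt M.I N.I 1 φ ((chartAt M.model x₀).symm z))
    (hy : φ ((chartAt M.model x₀).symm z) ∈ (chartAt N.model y₀).source) :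
    (mfderiv 𝓘(ℝ, N.model) N.I (chartAt N.model y₀).symm (localRep φ x₀ y₀ z) :
        N.model →L[ℝ] N.model).comp (fderiv ℝ (localRep φ x₀ y₀) z) =
      (D φ ((chartAt M.model x₀).symm z)).comp
        (mfderiv 𝓘(ℝ, M.model) M.I (chartAt M.model x₀).symm z : M.model →L[ℝ] M.model) := by
  have hrep : ContDiffAt ℝ 1 (localRep φ x₀ y₀) z :=
    contDiffAt_localRep (n := 1) hz hφ hy
  have hsymm : MDifferentiableAt 𝓘(ℝ, N.model) N.I (chartAt N.model y₀).symm
      (localRep φ x₀ y₀ z) :=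
    (contMDiffAt_chart_symm ((chartAt N.model y₀).map_source hy)).mdifferentiableAt (by simp)
  have h₁ := mfderiv_comp (I := 𝓘(ℝ, M.model)) (I' := 𝓘(ℝ, N.model)) (I'' := N.I) z hsymm
    (hrep.differentiableAt (by simp)).mdifferentiableAt
  have h₂ := mfderiv_comp (I := 𝓘(ℝ, M.model)) (I' := M.I) (I'' := N.I) z
    (hφ.mdifferentiableAt (by simp)) ((contMDiffAt_chart_symm hz).mdifferentiableAt (by simp))
  rw [mfderiv_eq_fderiv] at h₁
  refine h₁.symm.trans (Eq.trans ?_ h₂)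
  refine Filter.EventuallyEq.mfderiv_eq ?_
  have hc : ContinuousAt (φ ∘ (chartAt M.model x₀).symm) z :=
    hφ.continuousAt.comp ((chartAt M.model x₀).continuousAt_symm hz)
  filter_upwards [hc.preimage_mem_nhds ((chartAt N.model y₀).open_source.mem_nhds hy)] with z' hz'
  exact (chartAt N.model y₀).left_inv hz'

/-- In charts, the pull-back of forms is the pull-back by the expression of the map. -/
theorem inChart_pullback (θ : Form N k F) (hz : z ∈ (chartAt M.model x₀).target)
    (hφ : ContMDiffAt M.I N.I 1 φ ((chartAt M.model x₀).symm z))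
    (hy : φ ((chartAt M.model x₀).symm z) ∈ (chartAt N.model y₀).source) :
    (pullback φ θ).inChart x₀ =ᶠ[𝓝 z] fun z' =>
      (θ.inChart y₀ (localRep φ x₀ y₀ z')).compContinuousLinearMap
        (fderiv ℝ (localRep φ x₀ y₀) z') := by
  have hsymm := (chartAt M.model x₀).continuousAt_symm hz
  have hc : ContinuousAt (φ ∘ (chartAt M.model x₀).symm) z := hφ.continuousAt.comp hsymm
  -- Being `C^1` at a point, unlike differentiability there, persists on a neighbourhood, so the
  -- chain rule is available at all nearby `z'`.
  filter_upwards [hc.preimage_mem_nhds ((chartAt N.model y₀).open_source.mem_nhds hy),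
    (chartAt M.model x₀).open_target.mem_nhds hz,
    hsymm.eventually ((contMDiffAt_iff_contMDiffAt_nhds (by simp)).1 hφ)] with z' hy' hz' hφ'
  have hD := mfderiv_chart_symm_comp_fderiv_localRep hz' hφ' hy'
  have hl : (chartAt N.model y₀).symm (localRep φ x₀ y₀ z') = φ ((chartAt M.model x₀).symm z') :=
    (chartAt N.model y₀).left_inv hy'
  ext w
  simp only [inChart, hl]
  change θ _ _ = θ _ _
  congr 1
  funext i
  exact (DFunLike.congr_fun hD (w i)).symm

/-- Alternating maps in one variable are isometric to linear maps; under this identification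
pull-back becomes composition, which is continuous bilinear. -/
theorem contDiffAt_compContinuousLinearMap {E E' E'' : Type*} [NormedAddCommGroup E]
    [NormedSpace ℝ E] [NormedAddCommGroup E'] [NormedSpace ℝ E'] [NormedAddCommGroup E'']
    [NormedSpace ℝ E''] {n : ℕ∞ω} {α : E → E' [⋀^Fin 1]→L[ℝ] F} {T : E → E'' →L[ℝ] E'} {z : E}
    (hα : ContDiffAt ℝ n α z) (hT : ContDiffAt ℝ n T z) :
    ContDiffAt ℝ n (fun z => (α z).compContinuousLinearMap (T z)) z := by
  let e' := ContinuousAlternatingMap.ofSubsingletonLIE (𝕜 := ℝ) (E := E') (F := F) (0 : Fin 1)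
  let e'' := ContinuousAlternatingMap.ofSubsingletonLIE (𝕜 := ℝ) (E := E'') (F := F) (0 : Fin 1)
  have h : (fun z => (α z).compContinuousLinearMap (T z)) =
      fun z => e'' ((e'.symm (α z)).comp (T z)) := by
    funext z
    ext w
    change α z _ = α z _
    congr 1
    ext i
    fin_cases i
    rfl
  rw [h]
  exact e''.contDiff.contDiffAt.comp z ((e'.symm.contDiff.contDiffAt.comp z hα).clm_comp hT)

theorem Smooth.contDiffAt_inChart_pullback {θ : Form N 1 F} (hθ : θ.Smooth)
    (hz : z ∈ (chartAt M.model x₀).target)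
    (hφ : ContMDiffAt M.I N.I ∞ φ ((chartAt M.model x₀).symm z)) :
    ContDiffAt ℝ ∞ ((pullback φ θ).inChart x₀) z := by
  have hy := mem_chart_source N.model (φ ((chartAt M.model x₀).symm z))
  refine ContDiffAt.congr_of_eventuallyEq ?_
    (inChart_pullback θ hz (hφ.of_le (by simp)) hy)
  have hrep := contDiffAt_localRep (n := ⊤) hz hφ hy
  have hα := hθ.contDiffAt ((chartAt N.model _).map_source hy)
  have hcomp := ContDiffAt.comp (f := localRep φ x₀ _) z hα hrep
  exact contDiffAt_compContinuousLinearMap hcomp (hrep.fderiv_right (by simp))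

end Local

theorem Smooth.pullback {θ : Form N 1 F} (hθ : θ.Smooth) {φ : M → N} (hφ : IsSmooth φ) :
    (pullback φ θ).Smooth :=
  smooth_iff.2 fun _ _ hz => hθ.contDiffAt_inChart_pullback hz hφ.contMDiffAt

/-- `mfderiv` is by definition the derivative of the expression in the preferred charts at `x` and
`φ x`. -/
theorem fderiv_localRep_self {φ : M → N} {x : M} (hφ : MDifferentiableAt M.I N.I φ x) :
    fderiv ℝ (localRep φ x (φ x)) (chartAt M.model x x) = D φ x := by
  have h := hφ.mfderiv
  simp only [mfld_simps, fderivWithin_univ] at h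
  exact h.symm

/-- The exterior derivative is natural. -/
theorem d_pullback {θ : Form N k F} (hθ : θ.Smooth) {φ : M → N} (hφ : IsSmooth φ) :
    (Form.pullback φ θ).d = Form.pullback φ θ.d := by
  funext x
  have hz := mem_chart_target M.model x
  have hx : (chartAt M.model x).symm (chartAt M.model x x) = x :=
    (chartAt M.model x).left_inv (mem_chart_source M.model x)
  have hy : φ ((chartAt M.model x).symm (chartAt M.model x x)) ∈
      (chartAt N.model (φ x)).source := by
    rw [hx]
    exact mem_chart_source N.model (φ x)
  have hrep := contDiffAt_localRep (n := ⊤) hz hφ.contMDiffAt hy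
  have hl : localRep φ x (φ x) (chartAt M.model x x) = chartAt N.model (φ x) (φ x) := by
    rw [localRep, hx]
  have hdiff : DifferentiableAt ℝ (θ.inChart (φ x))
      (localRep φ x (φ x) (chartAt M.model x x)) := by
    rw [hl]
    exact (hθ.contDiffAt (mem_chart_target N.model (φ x))).differentiableAt (by simp)
  -- Naturality of `extDeriv` rests on the symmetry of the second derivative of the map, for which
  -- `C^2` is enough over `ℝ`.
  have h2 : minSmoothness ℝ 2 ≤ ∞ := by
    rw [minSmoothness_of_isRCLikeNormedField]
    exact WithTop.coe_le_coe.2 (le_top : (2 : ℕ∞) ≤ ⊤)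
  rw [d, (inChart_pullback θ hz (hφ.contMDiffAt.of_le (by simp)) hy).extDeriv_eq,
    extDeriv_pullback hdiff hrep h2, hl,
    fderiv_localRep_self (hφ.contMDiffAt.mdifferentiableAt (by simp))]
  rfl

theorem d_sub {θ θ' : Form M k F} (h : θ.Smooth) (h' : θ'.Smooth) : (θ - θ').d = θ.d - θ'.d := by
  funext x
  have hz := mem_chart_target M.model x
  have e : θ = (θ - θ') + θ' := (sub_add_cancel θ θ').symm
  rw [Pi.sub_apply, eq_sub_iff_add_eq]
  simp only [d]
  rw [← extDeriv_add (((h.sub h').contDiffAt hz).differentiableAt (by simp))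
    ((h'.contDiffAt hz).differentiableAt (by simp))]
  conv_rhs => rw [e]
  rfl

end Form
-- Principal bundles and descent of forms to the base.
section Descent

variable {K EK : Type*} [NormedAddCommGroup EK] [NormedSpace ℝ EK]
  [TopologicalSpace K] [ChartedSpace EK K] [Group K] {M B : Mfd.{u}} [MulAction K M] {q : M → B}

theorem mdifferentiable_smul_const [ContMDiffSMul 𝓘(ℝ, EK) M.I ∞ K M] (x : M) :
    MDifferentiable 𝓘(ℝ, EK) M.I (fun g : K => g • x) :=
  ((contMDiff_smul (I := 𝓘(ℝ, EK)) (I' := M.I) (n := ∞) (G := K) (M := M)).comp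
    (contMDiff_id.prodMk contMDiff_const)).mdifferentiable (by simp)

variable (EK) in
theorem isSmooth_smul [ContMDiffSMul 𝓘(ℝ, EK) M.I ∞ K M] (g : K) :
    IsSmooth (fun x : M => g • x) :=
  (contMDiff_smul (I := 𝓘(ℝ, EK)) (I' := M.I) (n := ∞) (G := K) (M := M)).comp
    (contMDiff_const.prodMk contMDiff_id)

/-- Every velocity along an orbit is a value of a generated vector field. -/
theorem exists_infAct_eq [LieGroup 𝓘(ℝ, EK) ∞ K] [ContMDiffSMul 𝓘(ℝ, EK) M.I ∞ K M]
    (g : K) (x : M) (v : EK) :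
    ∃ X : EK, infAct K X (g • x) = (mfderiv 𝓘(ℝ, EK) M.I (fun k : K => k • x) g : EK →L[ℝ] _) v := by
  -- Write `k • x = (k * g⁻¹) • (g • x)`: right translation by `g⁻¹` carries `g` to `1`, and its
  -- differential carries `v` to the required `X`.
  have hr : MDifferentiableAt 𝓘(ℝ, EK) 𝓘(ℝ, EK) (fun k : K => k * g⁻¹) g :=
    ((contMDiff_mul_right (I := 𝓘(ℝ, EK)) (n := ∞) (a := g⁻¹)).mdifferentiable (by simp)) g
  have h1 : g * g⁻¹ = 1 := mul_inv_cancel g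
  have ha : MDifferentiableAt 𝓘(ℝ, EK) M.I (fun k : K => k • g • x) (g * g⁻¹) :=
    mdifferentiable_smul_const (g • x) _
  have hc := mfderiv_comp g ha hr
  have he : (fun k : K => k • g • x) ∘ (fun k : K => k * g⁻¹) = fun k : K => k • x := by
    funext k
    simp [mul_smul]
  rw [he] at hc
  rw [h1] at hc
  exact ⟨(mfderiv 𝓘(ℝ, EK) 𝓘(ℝ, EK) (fun k : K => k * g⁻¹) g : EK →L[ℝ] EK) v,
    (congrArg (fun T : EK →L[ℝ] M.model => T v) hc).symm⟩

/-- Chain rule at `1` for two mutually inverse conjugations. It cancels the twist of a connection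
form against that of `λ`. -/
theorem Ad_inv_Ad [LieGroup 𝓘(ℝ, EK) ∞ K] (g : K) (X : EK) : Ad K g⁻¹ (Ad K g X) = X := by
  have hs : ∀ a : K, MDifferentiable 𝓘(ℝ, EK) 𝓘(ℝ, EK) (fun h : K => a * h * a⁻¹) := fun a =>
    ((contMDiff_mul_right (I := 𝓘(ℝ, EK)) (n := ∞) (a := a⁻¹)).comp
      (contMDiff_mul_left (I := 𝓘(ℝ, EK)) (n := ∞) (a := a))).mdifferentiable (by simp)
  have h1 : g * 1 * g⁻¹ = 1 := by simp
  have hc := mfderiv_comp (1 : K) (hs g⁻¹ _) (hs g 1)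
  have he : (fun h : K => g⁻¹ * h * g⁻¹⁻¹) ∘ (fun h : K => g * h * g⁻¹) = id := by
    funext h
    simp [mul_assoc]
  rw [he, mfderiv_id, h1] at hc
  exact (congrArg (fun T : EK →L[ℝ] EK => T X) hc).symm

namespace IsQuotient

theorem isSmooth (hq : IsQuotient K EK q) : IsSmooth q := hq.smooth_proj

/-- What is new compared with `locally_trivial` is `q (σ y) = y`: any `p` over `y` is `τ p • σ y`,
hence lies in the orbit of `σ y`. -/
theorem exists_section (hq : IsQuotient K EK q) (x : B) :
    ∃ U : Set B, IsOpen U ∧ x ∈ U ∧ ∃ (σ : B → M) (τ : M → K),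
      ContMDiffOn B.I M.I ∞ σ U ∧ ContMDiffOn M.I 𝓘(ℝ, EK) ∞ τ (q ⁻¹' U) ∧
      (∀ p : M, q p ∈ U → τ p • σ (q p) = p) ∧ ∀ y ∈ U, q (σ y) = y := by
  obtain ⟨U, hU, hx, σ, τ, hσ, hτ, h⟩ := hq.locally_trivial x (Set.mem_univ x)
  rw [Set.inter_univ] at hσ
  refine ⟨U, hU, hx, σ, τ, hσ, hτ, h, fun y hy => ?_⟩
  obtain ⟨p, rfl⟩ : y ∈ Set.range q := hq.range_proj ▸ Set.mem_univ y
  exact (hq.fibre _ _).2 ⟨τ p, h p hy⟩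

variable {k : ℕ} {F : Type*} [NormedAddCommGroup F] [NormedSpace ℝ F]

/-- Forms on the base of a principal bundle are determined by their pull-backs. -/
theorem pullback_injective (hq : IsQuotient K EK q) {θ θ' : Form B k F}
    (h : Form.pullback q θ = Form.pullback q θ') : θ = θ' := by
  funext x
  obtain ⟨U, hU, hx, σ, -, hσ, -, -, hqσ⟩ := hq.exists_section x
  have hUx := hU.mem_nhds hx
  -- Since `q ∘ σ` is the identity near `x`, every tangent vector `w` at `x` is the image under `D
  -- q` of `D σ x w`, where the pull-backs can be compared.
  have hD : (D q (σ x)).comp (D σ x) = ContinuousLinearMap.id ℝ B.model := by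
    rw [← D_comp (hq.isSmooth.mdifferentiable (by simp) _)
      ((hσ.contMDiffAt hUx).mdifferentiableAt (by simp)), ← D_id x]
    refine D_congr ?_
    filter_upwards [hUx] with y hy using hqσ y hy
  ext w
  have hw := DFunLike.congr_fun (congrFun h (σ x)) fun i => D σ x (w i)
  rw [Form.pullback_apply, Form.pullback_apply, hqσ x hx] at hw
  have hv : (fun i => D q (σ x) (D σ x (w i))) = w :=
    funext fun i => DFunLike.congr_fun hD (w i)
  rwa [hv] at hw

/-- An invariant horizontal 1-form agrees with its pull-back along a local section followed by the
projection. -/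
theorem pullback_section_comp [LieGroup 𝓘(ℝ, EK) ∞ K] (hq : IsQuotient K EK q)
    {ε : Form M 1 F} (hinv : ε.Invariant K) (hhor : ∀ (X : EK) (p : M), ε p ![infAct K X p] = 0)
    {U : Set B} (hU : IsOpen U) {σ : B → M} {τ : M → K} (hσ : ContMDiffOn B.I M.I ∞ σ U)
    (hτ : ContMDiffOn M.I 𝓘(ℝ, EK) ∞ τ (q ⁻¹' U))
    (h : ∀ p : M, q p ∈ U → τ p • σ (q p) = p) {p : M} (hp : q p ∈ U) (w : M.model) :
    ε (σ (q p)) ![D σ (q p) (D q p w)] = ε p ![w] := by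
  have := hq.smooth_smul
  have hqp : MDifferentiableAt M.I B.I q p := hq.isSmooth.mdifferentiable (by simp) p
  have hσp : MDifferentiableAt B.I M.I σ (q p) :=
    (hσ.contMDiffAt (hU.mem_nhds hp)).mdifferentiableAt (by simp)
  have hUp : q ⁻¹' U ∈ 𝓝 p := (hU.preimage hq.isSmooth.continuous).mem_nhds hp
  have hτp : MDifferentiableAt M.I 𝓘(ℝ, EK) τ p :=
    (hτ.contMDiffAt hUp).mdifferentiableAt (by simp)
  have hs : MDifferentiableAt M.I M.I (σ ∘ q) p := hσp.comp p hqp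
  have hact : MDifferentiableAt (𝓘(ℝ, EK).prod M.I) M.I (fun z : K × M => z.1 • z.2)
      (τ p, (σ ∘ q) p) :=
    (contMDiff_smul (I := 𝓘(ℝ, EK)) (I' := M.I) (n := ∞)).mdifferentiable (by simp) _
  have hid : (fun y : M => y) =ᶠ[𝓝 p]
      (fun z : K × M => z.1 • z.2) ∘ fun y => (τ y, (σ ∘ q) y) := by
    filter_upwards [hUp] with y hy using (h y hy).symm
  let v : EK := (mfderiv M.I 𝓘(ℝ, EK) τ p : M.model →L[ℝ] EK) w
  let T : EK →L[ℝ] M.model := mfderiv 𝓘(ℝ, EK) M.I (fun k : K => k • σ (q p)) (τ p)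
  -- Differentiating `y = τ y • σ (q y)` at `p` splits `w` into a part along the orbit and the
  -- translate by `τ p` of the vector `D (σ ∘ q) p w`.
  have hw : w = T v + D (fun y : M => τ p • y) (σ (q p)) (D (σ ∘ q) p w) := by
    have h1 : w = D (fun y : M => y) p w := by rw [D_id]; rfl
    rw [D_congr hid] at h1
    have h2 : D ((fun z : K × M => z.1 • z.2) ∘ fun y => (τ y, (σ ∘ q) y)) p w =
      (mfderiv (𝓘(ℝ, EK).prod M.I) M.I (fun z : K × M => z.1 • z.2) (τ p, (σ ∘ q) p) :
        EK × M.model →L[ℝ] M.model) ((mfderiv M.I (𝓘(ℝ, EK).prod M.I)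
          (fun y => (τ y, (σ ∘ q) y)) p : M.model →L[ℝ] EK × M.model) w) :=
      DFunLike.congr_fun (mfderiv_comp p hact (hτp.prodMk hs)) w
    rw [hτp.mfderiv_prod hs] at h2
    exact h1.trans (h2.trans (mfderiv_prod_eq_add_apply hact))
  obtain ⟨X, hX⟩ := exists_infAct_eq (τ p) (σ (q p)) v
  change _ = T v at hX
  have hi := DFunLike.congr_fun (congrFun (hinv (τ p)) (σ (q p))) ![D (σ ∘ q) p w]
  rw [Form.pullback_apply_one] at hi
  have hadd : ∀ a b : M.model, ε p ![a + b] = ε p ![a] + ε p ![b] := fun a b => by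
    have hu : ∀ c : M.model, Function.update ![(0 : M.model)] 0 c = ![c] := fun c => by
      ext i
      fin_cases i
      rfl
    have := (ε p).map_update_add ![0] 0 a b
    rwa [hu, hu, hu] at this
  rw [← hX, h p hp] at hw
  rw [h p hp] at hi
  rw [D_comp hσp hqp] at hi hw
  -- Horizontality kills the orbit part; invariance under `τ p` identifies the remaining term with
  -- the value at `σ (q p)`.
  conv_rhs => rw [hw, hadd, hhor, zero_add]
  exact hi.symm

/-- Smooth invariant horizontal 1-forms descend to the base. -/
theorem exists_descent [LieGroup 𝓘(ℝ, EK) ∞ K] (hq : IsQuotient K EK q)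
    {ε : Form M 1 F} (hε : ε.Smooth) (hinv : ε.Invariant K)
    (hhor : ∀ (X : EK) (p : M), ε p ![infAct K X p] = 0) :
    ∃ θ : Form B 1 F, θ.Smooth ∧ Form.pullback q θ = ε := by
  choose U hU hxU σ τ hσ hτ h hqσ using hq.exists_section
  -- Each point `x` uses its own section `σ x`, so the smoothness of `θ` is not visible from this
  -- formula.
  let θ : Form B 1 F := fun x => Form.pullback (σ x) ε x
  have hθ : Form.pullback q θ = ε := by
    refine Form.ext_one fun p w => ?_
    rw [Form.pullback_apply_one, Form.pullback_apply_one]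
    exact hq.pullback_section_comp hinv hhor (hU _) (hσ _) (hτ _) (h _) (hxU _) w
  refine ⟨θ, Form.smooth_iff.2 fun x₀ z hz => ?_, hθ⟩
  set x := (chartAt B.model x₀).symm z with hx
  have hsx : ContMDiffAt B.I M.I ∞ (σ x) x := (hσ x).contMDiffAt ((hU x).mem_nhds (hxU x))
  refine (hε.contDiffAt_inChart_pullback hz hsx).congr_of_eventuallyEq ?_
  -- Near `x` the form `θ` equals the pull-back of `ε` along the single section `σ x`: substitute `ε
  -- = q^* θ` and use that `q ∘ σ x` is the identity there.
  refine Form.inChart_congr hz ?_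
  filter_upwards [(hU x).mem_nhds (hxU x)] with y hy
  have hsy : MDifferentiableAt B.I M.I (σ x) y :=
    ((hσ x).contMDiffAt ((hU x).mem_nhds hy)).mdifferentiableAt (by simp)
  have hD : (D q (σ x y)).comp (D (σ x) y) = ContinuousLinearMap.id ℝ B.model := by
    rw [← D_comp (hq.isSmooth.mdifferentiable (by simp) _) hsy, ← D_id y]
    refine D_congr ?_
    filter_upwards [(hU x).mem_nhds hy] with y' hy' using hqσ x y' hy'
  clear_value θ
  ext w
  rw [Form.pullback_apply, ← hθ, Form.pullback_apply, hqσ x y hy]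
  exact congrArg (θ y) (funext fun i => (DFunLike.congr_fun hD (w i)).symm)

end IsQuotient

end Descent

/-! ### The form `κ`: smoothness, horizontality, invariance. -/

section Kappa

theorem Form.Smooth.clm_comp {M : Mfd.{u}} {E F : Type*} [NormedAddCommGroup E] [NormedSpace ℝ E]
    [NormedAddCommGroup F] [NormedSpace ℝ F] {l : M → E →L[ℝ] F} {θ : Form M 1 E}
    (hl : ContMDiff M.I 𝓘(ℝ, E →L[ℝ] F) ∞ l) (hθ : θ.Smooth) :
    Form.Smooth (fun x => (l x).compContinuousAlternatingMap (θ x) : Form M 1 F) := by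
  refine Form.smooth_iff.2 fun x₀ z hz => ?_
  let e := ContinuousAlternatingMap.ofSubsingletonLIE (𝕜 := ℝ) (E := M.model) (F := E) (0 : Fin 1)
  let e' := ContinuousAlternatingMap.ofSubsingletonLIE (𝕜 := ℝ) (E := M.model) (F := F) (0 : Fin 1)
  have h : Form.inChart (fun x => (l x).compContinuousAlternatingMap (θ x) : Form M 1 F) x₀ =
      fun z => e' ((l ((chartAt M.model x₀).symm z)).comp (e.symm (θ.inChart x₀ z))) := by
    funext z
    ext w
    change l _ (θ _ _) = l _ (θ _ _)
    congr 2
    ext i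
    fin_cases i
    rfl
  have hl' : ContDiffAt ℝ ∞ (fun z => l ((chartAt M.model x₀).symm z)) z := by
    rw [← contMDiffAt_iff_contDiffAt]
    exact (hl _).comp z (Form.contMDiffAt_chart_symm hz)
  rw [h]
  exact e'.contDiff.contDiffAt.comp z
    (hl'.clm_comp (e.symm.contDiff.contDiffAt.comp z (hθ.contDiffAt hz)))

variable {G EG : Type*} [NormedAddCommGroup EG] [NormedSpace ℝ EG]
  [TopologicalSpace G] [ChartedSpace EG G] [Group G] {M : Mfd.{u}} [MulAction G M]
  {𝒢 : BundleGerbe M} [MulAction G 𝒢.Y] {lam : 𝒢.Y → (EG →L[ℝ] ℝ)}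

theorem BundleGerbe.isSmooth_π (𝒢 : BundleGerbe M) : IsSmooth 𝒢.π := 𝒢.π_submersion.contMDiff

theorem smooth_kappa {Ξ : Form M 1 EG} (hΞ : Ξ.Smooth)
    (hlam : ContMDiff 𝒢.Y.I 𝓘(ℝ, EG →L[ℝ] ℝ) ∞ lam) : (kappa Ξ lam).Smooth :=
  Form.Smooth.clm_comp hlam (hΞ.pullback 𝒢.isSmooth_π)

theorem kappa_sub (Ξ Ξ' : Form M 1 EG) (lam : 𝒢.Y → (EG →L[ℝ] ℝ)) :
    kappa (Ξ - Ξ') lam = kappa Ξ lam - kappa Ξ' lam := by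
  funext y
  ext w
  exact map_sub (lam y) _ _

theorem kappa_apply (Ξ : Form M 1 EG) (lam : 𝒢.Y → (EG →L[ℝ] ℝ)) (y : 𝒢.Y) (w : 𝒢.Y.model) :
    kappa Ξ lam y ![w] = lam y (Ξ (𝒢.π y) ![D 𝒢.π y w]) :=
  congrArg (lam y) (Form.pullback_apply_one 𝒢.π Ξ y w)

/-- Differentiate `𝒢.π (g • y) = g • 𝒢.π y` in `g` at `1`. -/
theorem D_π_infAct [ContMDiffSMul 𝓘(ℝ, EG) 𝒢.Y.I ∞ G 𝒢.Y]
    (hπ : ∀ (g : G) (y : 𝒢.Y), 𝒢.π (g • y) = g • 𝒢.π y) (X : EG) (y : 𝒢.Y) :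
    D 𝒢.π y (infAct G X y) = infAct G X (𝒢.π y) := by
  have h1 : (1 : G) • y = y := one_smul G y
  have hc := mfderiv_comp (1 : G)
    (𝒢.isSmooth_π.mdifferentiable (by simp) ((1 : G) • y))
    (mdifferentiable_smul_const (EK := EG) y 1)
  have he : 𝒢.π ∘ (fun g : G => g • y) = fun g : G => g • 𝒢.π y := funext fun g => hπ g y
  rw [he, h1] at hc
  exact (congrArg (fun T : EG →L[ℝ] M.model => T X) hc).symm

/-- Meant for a difference of connections: for a connection itself the value would be `lam y X`
instead of `0`. -/
theorem kappa_horizontal [ContMDiffSMul 𝓘(ℝ, EG) 𝒢.Y.I ∞ G 𝒢.Y]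
    (hπ : ∀ (g : G) (y : 𝒢.Y), 𝒢.π (g • y) = g • 𝒢.π y) {Θ : Form M 1 EG}
    (hΘ : ∀ (X : EG) (x : M), Θ x ![infAct G X x] = 0) (X : EG) (y : 𝒢.Y) :
    kappa Θ lam y ![infAct G X y] = 0 := by
  rw [kappa_apply, D_π_infAct hπ, hΘ, map_zero]

/-- Under `g` the form `Θ` acquires `Ad G g` and `lam` acquires `Ad G g⁻¹`; in the pairing they
cancel. -/
theorem kappa_invariant [LieGroup 𝓘(ℝ, EG) ∞ G] [ContMDiffSMul 𝓘(ℝ, EG) M.I ∞ G M]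
    [ContMDiffSMul 𝓘(ℝ, EG) 𝒢.Y.I ∞ G 𝒢.Y]
    (hπ : ∀ (g : G) (y : 𝒢.Y), 𝒢.π (g • y) = g • 𝒢.π y) {Θ : Form M 1 EG}
    (hΘ : ∀ (g : G) (x : M) (w : M.model),
      Form.pullback (fun y : M => g • y) Θ x ![w] = Ad G g (Θ x ![w]))
    (hlam : ∀ (g : G) (X : EG) (y : 𝒢.Y), lam (g • y) X = lam y (Ad G g⁻¹ X)) :
    (kappa Θ lam).Invariant G := by
  intro g
  refine Form.ext_one fun y w => ?_
  have hD : D 𝒢.π (g • y) (D (fun y : 𝒢.Y => g • y) y w) =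
      D (fun x : M => g • x) (𝒢.π y) (D 𝒢.π y w) := by
    have hsY := (isSmooth_smul (M := 𝒢.Y) EG g).mdifferentiable (by simp)
    have hsM := (isSmooth_smul (M := M) EG g).mdifferentiable (by simp)
    have hsπ := 𝒢.isSmooth_π.mdifferentiable (by simp)
    have h₁ := D_comp (x := y) (hsπ (g • y)) (hsY y)
    have h₂ := D_comp (x := y) (hsM (𝒢.π y)) (hsπ y)
    have he : 𝒢.π ∘ (fun y : 𝒢.Y => g • y) = (fun x : M => g • x) ∘ 𝒢.π := funext fun y => hπ g y
    rw [he] at h₁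
    exact DFunLike.congr_fun (h₁.symm.trans h₂) w
  have hg := hΘ g (𝒢.π y) (D 𝒢.π y w)
  rw [Form.pullback_apply_one] at hg
  rw [Form.pullback_apply_one, kappa_apply, kappa_apply, hD, hπ, hg, hlam, Ad_inv_Ad]

end Kappa
-- The canonical stable isomorphism of a bundle gerbe with itself, and its shift by a 1-form.
namespace BundleGerbe

variable {M : Mfd.{u}} (𝒢 : BundleGerbe M)

theorem isSmooth_pr₁ : IsSmooth 𝒢.pr₁ := contMDiff_fst.comp 𝒢.principal.smooth_proj

theorem isSmooth_pr₂ : IsSmooth 𝒢.pr₂ := contMDiff_snd.comp 𝒢.principal.smooth_proj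

theorem δ_sub {k : ℕ} (θ θ' : Form 𝒢.Y k ℝ) : 𝒢.δ (θ - θ') = 𝒢.δ θ - 𝒢.δ θ' := by
  rw [δ, Form.pullback_sub, Form.pullback_sub]
  exact sub_sub_sub_comm _ _ _ _

theorem isSmooth_circle_smul (z : Circle) : IsSmooth (fun p : 𝒢.P => z • p) :=
  have := 𝒢.principal.smooth_smul
  isSmooth_smul (EuclideanSpace ℝ (Fin 1)) z

theorem proj_circle_smul (z : Circle) (p : 𝒢.P) : 𝒢.proj (z • p) = 𝒢.proj p :=
  ((𝒢.principal.fibre p (z • p)).2 ⟨z, rfl⟩).symm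

theorem pr₂_circle_smul (z : Circle) (p : 𝒢.P) : 𝒢.pr₂ (z • p) = 𝒢.pr₂ p :=
  congrArg Prod.snd (𝒢.proj_circle_smul z p)

theorem π_pr₁ (p : 𝒢.P) : 𝒢.π (𝒢.proj p).1 = 𝒢.π (𝒢.proj p).2 :=
  show 𝒢.proj p ∈ {y : 𝒢.Y × 𝒢.Y | 𝒢.π y.1 = 𝒢.π y.2} from
    𝒢.principal.range_proj ▸ Set.mem_range_self p

theorem exists_proj_eq {y₁ y₂ : 𝒢.Y} (h : 𝒢.π y₁ = 𝒢.π y₂) : ∃ p : 𝒢.P, 𝒢.proj p = (y₁, y₂) := by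
  have : (y₁, y₂) ∈ Set.range 𝒢.proj := by
    rw [𝒢.principal.range_proj]
    exact h
  exact this

/-- Smooth local sections of `P` over the fibre product `Y^{[2]}`. -/
theorem exists_local_section {y : 𝒢.Y × 𝒢.Y} (hy : 𝒢.π y.1 = 𝒢.π y.2) :
    ∃ U : Set (𝒢.Y × 𝒢.Y), IsOpen U ∧ y ∈ U ∧ ∃ σ : 𝒢.Y × 𝒢.Y → 𝒢.P,
      ContMDiffOn (𝒢.Y.I.prod 𝒢.Y.I) 𝒢.P.I ∞ σ (U ∩ {y | 𝒢.π y.1 = 𝒢.π y.2}) ∧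
      ∀ z ∈ U, 𝒢.π z.1 = 𝒢.π z.2 → 𝒢.proj (σ z) = z := by
  obtain ⟨U, hU, hyU, σ, τ, hσ, -, h⟩ := 𝒢.principal.locally_trivial y hy
  refine ⟨U, hU, hyU, σ, hσ, fun z hz hπ => ?_⟩
  obtain ⟨p, rfl : 𝒢.proj p = z⟩ := 𝒢.exists_proj_eq hπ
  exact (𝒢.principal.fibre _ _).2 ⟨τ p, h p hz⟩

/-- The curve `t ↦ Circle.exp t • p` stays in one fibre, so its image under `pr₂` is constant. -/
theorem D_pr₂_circleField (p : 𝒢.P) : D 𝒢.pr₂ p (circleField p) = 0 := by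
  have := 𝒢.principal.smooth_smul
  have hc : MDifferentiableAt 𝓘(ℝ, ℝ) 𝒢.P.I (fun t : ℝ => Circle.exp t • p) 0 :=
    (mdifferentiable_smul_const (EK := EuclideanSpace ℝ (Fin 1)) p _).comp 0
      ((contMDiff_circleExp (m := ∞)).mdifferentiable (by simp) 0)
  have h0 : Circle.exp 0 • p = p := by simp
  have h := vel_comp (𝒢.isSmooth_pr₂.mdifferentiable (by simp) (Circle.exp 0 • p)) hc
  simp only [h0, pr₂_circle_smul, vel_const] at h
  exact h.symm

/-- Changing a connection by a form pulled back along `P → Y`, `(y₁, y₂) ↦ y₂`. -/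
theorem isCircleConnection_sub_pullback {A : Form 𝒢.P 1 ℝ} (hA : IsCircleConnection A)
    {ε : Form 𝒢.Y 1 ℝ} (hε : ε.Smooth) :
    IsCircleConnection (A - Form.pullback 𝒢.pr₂ ε) where
  smooth := hA.smooth.sub (hε.pullback 𝒢.isSmooth_pr₂)
  vertical p := by
    change A p ![circleField p] - Form.pullback 𝒢.pr₂ ε p ![circleField p] = 1
    rw [hA.vertical, Form.pullback_apply_one, D_pr₂_circleField,
      (ε _).map_coord_zero (m := ![0]) 0 rfl, sub_zero]
  invariant z := by
    rw [Form.pullback_sub, hA.invariant z, Form.pullback_comp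
      (𝒢.isSmooth_pr₂.mdifferentiable (by simp))
      ((𝒢.isSmooth_circle_smul z).mdifferentiable (by simp))]
    congr 2
    exact funext (𝒢.pr₂_circle_smul z)

/-- `s(p', w, r₁) · s(r₂, w, p)⁻¹` for any `w` over `(y₁, y₂')`: the canonical section of
`R_{z₂}^{-1} ⊗ R_{z₁} ⊗ P_{(y₁, y₂)}^{-1} ⊗ P_{(y₁', y₂')}` for `R = P`. -/
def transition (r₂ r₁ p p' : 𝒢.P) : Circle :=
  open Classical in
  if h : ∃ w, 𝒢.proj w = ((𝒢.proj r₁).1, (𝒢.proj r₂).2) then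
    𝒢.s p' h.choose r₁ * (𝒢.s r₂ h.choose p)⁻¹
  else 1

section Transition

variable {𝒢} {r₂ r₁ p p' w : 𝒢.P}

/-- Two choices of `w` differ by some `z` in the circle, by which both values of `s` get multiplied,
so the quotient is unchanged. This freedom allows `w` to be chosen smoothly or shared between
different values of `transition`. -/
theorem transition_eq (hp : 𝒢.proj p = ((𝒢.proj r₁).1, (𝒢.proj r₂).1))
    (hp' : 𝒢.proj p' = ((𝒢.proj r₁).2, (𝒢.proj r₂).2))
    (hw : 𝒢.proj w = ((𝒢.proj r₁).1, (𝒢.proj r₂).2)) :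
    𝒢.transition r₂ r₁ p p' = 𝒢.s p' w r₁ * (𝒢.s r₂ w p)⁻¹ := by
  have h : ∃ w, 𝒢.proj w = ((𝒢.proj r₁).1, (𝒢.proj r₂).2) := ⟨w, hw⟩
  rw [transition, dif_pos h]
  obtain ⟨z, hz⟩ := (𝒢.principal.fibre w h.choose).1 (hw.trans h.choose_spec.symm)
  have h₁ := 𝒢.s_equivariant _ _ _ p' w r₁ hp' hw rfl 1 z 1
  have h₂ := 𝒢.s_equivariant _ _ _ r₂ w p rfl hw hp 1 z 1
  simp only [one_smul, inv_one, one_mul, mul_one] at h₁ h₂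
  rw [← hz, h₁, h₂, mul_inv, mul_mul_mul_comm, mul_inv_cancel, one_mul]

theorem π_transition (hp : 𝒢.proj p = ((𝒢.proj r₁).1, (𝒢.proj r₂).1)) :
    𝒢.π (𝒢.proj r₁).1 = 𝒢.π (𝒢.proj r₂).2 := by
  have h := 𝒢.π_pr₁ p
  rw [hp] at h
  exact h.trans (𝒢.π_pr₁ r₂)

theorem isTriple_right (hp' : 𝒢.proj p' = ((𝒢.proj r₁).2, (𝒢.proj r₂).2))
    (hw : 𝒢.proj w = ((𝒢.proj r₁).1, (𝒢.proj r₂).2)) : 𝒢.IsTriple p' w r₁ :=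
  ⟨_, _, _, hp', hw, rfl⟩

theorem isTriple_left (hp : 𝒢.proj p = ((𝒢.proj r₁).1, (𝒢.proj r₂).1))
    (hw : 𝒢.proj w = ((𝒢.proj r₁).1, (𝒢.proj r₂).2)) : 𝒢.IsTriple r₂ w p :=
  ⟨_, _, _, rfl, hw, hp⟩

theorem transition_smul (hp : 𝒢.proj p = ((𝒢.proj r₁).1, (𝒢.proj r₂).1))
    (hp' : 𝒢.proj p' = ((𝒢.proj r₁).2, (𝒢.proj r₂).2)) (a b c e : Circle) :
    𝒢.transition (a • r₂) (b • r₁) (c • p) (e • p') =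
      a * b⁻¹ * c * e⁻¹ * 𝒢.transition r₂ r₁ p p' := by
  obtain ⟨w, hw⟩ := 𝒢.exists_proj_eq (π_transition hp)
  have h₁ := 𝒢.s_equivariant _ _ _ p' w r₁ hp' hw rfl e 1 b
  have h₂ := 𝒢.s_equivariant _ _ _ r₂ w p rfl hw hp a 1 c
  rw [one_smul] at h₁ h₂
  rw [transition_eq hp hp' hw, transition_eq (w := w) (by simpa only [proj_circle_smul] using hp)
    (by simpa only [proj_circle_smul] using hp') (by simpa only [proj_circle_smul] using hw),
    h₁, h₂]
  simp [mul_comm, mul_left_comm, mul_assoc]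

/-- The arithmetic of `transition_cocycle`, stated additively so that `abel` applies: the difference
of the two sides is `h₃` minus `h₁` minus `h₂`. -/
theorem add_cocycle_eq {α : Type*} [AddCommGroup α] {A B P X Q W E F T V : α}
    (h₁ : A + -B + X + -P = 0) (h₂ : Q + -W + E + -F = 0) (h₃ : T + -W + X + -V = 0) :
    (T + -A) + -(E + -B) + (F + -V) = -P + Q := by
  have h : (T + -A) + -(E + -B) + (F + -V) - (-P + Q) =
      (T + -W + X + -V) - (A + -B + X + -P) - (Q + -W + E + -F) := by abel
  rw [h₁, h₂, h₃, sub_zero, sub_zero] at h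
  exact sub_eq_zero.1 h

/-- With `r_i` over `(y_i, y_i')`, this combines `δs = 1` at the three points `(y₁, y₂, y₃, y₃')`,
`(y₁, y₁', y₂', y₃')` and `(y₁, y₂, y₂', y₃')` of `Y^{[4]}`. All auxiliary `w_ij` over `(y_i, y_j')`
cancel. -/
theorem transition_cocycle {r₁ r₂ r₃ p₁₂ p₁₃ p₂₃ p₁₂' p₁₃' p₂₃' : 𝒢.P}
    (h₁₂ : 𝒢.proj p₁₂ = ((𝒢.proj r₁).1, (𝒢.proj r₂).1))
    (h₁₃ : 𝒢.proj p₁₃ = ((𝒢.proj r₁).1, (𝒢.proj r₃).1))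
    (h₂₃ : 𝒢.proj p₂₃ = ((𝒢.proj r₂).1, (𝒢.proj r₃).1))
    (h₁₂' : 𝒢.proj p₁₂' = ((𝒢.proj r₁).2, (𝒢.proj r₂).2))
    (h₁₃' : 𝒢.proj p₁₃' = ((𝒢.proj r₁).2, (𝒢.proj r₃).2))
    (h₂₃' : 𝒢.proj p₂₃' = ((𝒢.proj r₂).2, (𝒢.proj r₃).2)) :
    𝒢.transition r₃ r₂ p₂₃ p₂₃' * (𝒢.transition r₃ r₁ p₁₃ p₁₃')⁻¹ *
      𝒢.transition r₂ r₁ p₁₂ p₁₂' = (𝒢.s p₂₃ p₁₃ p₁₂)⁻¹ * 𝒢.s p₂₃' p₁₃' p₁₂' := by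
  obtain ⟨w₁₂, hw₁₂⟩ := 𝒢.exists_proj_eq (π_transition h₁₂)
  obtain ⟨w₁₃, hw₁₃⟩ := 𝒢.exists_proj_eq (π_transition h₁₃)
  obtain ⟨w₂₃, hw₂₃⟩ := 𝒢.exists_proj_eq (π_transition h₂₃)
  rw [transition_eq h₁₂ h₁₂' hw₁₂, transition_eq h₁₃ h₁₃' hw₁₃, transition_eq h₂₃ h₂₃' hw₂₃]
  exact add_cocycle_eq (α := Additive Circle)
    (𝒢.δs _ _ _ _ p₁₂ p₁₃ w₁₃ p₂₃ w₂₃ r₃ h₁₂ h₁₃ hw₁₃ h₂₃ hw₂₃ rfl)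
    (𝒢.δs _ _ _ _ r₁ w₁₂ w₁₃ p₁₂' p₁₃' p₂₃' rfl hw₁₂ hw₁₃ h₁₂' h₁₃' h₂₃')
    (𝒢.δs _ _ _ _ p₁₂ w₁₂ w₁₃ r₂ w₂₃ p₂₃' h₁₂ hw₁₂ hw₁₃ rfl hw₂₃ h₂₃')

/-- The `w` chosen in the definition need not vary continuously, but by `transition_eq` it may be
replaced locally by a smooth section of `P` evaluated at `(y₁, y₂')`. -/
theorem transition_smooth :
    ContMDiffOn (𝒢.P.I.prod (𝒢.P.I.prod (𝒢.P.I.prod 𝒢.P.I))) (𝓡 1) ∞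
      (fun w : 𝒢.P × 𝒢.P × 𝒢.P × 𝒢.P => 𝒢.transition w.1 w.2.1 w.2.2.1 w.2.2.2)
      {w | 𝒢.proj w.2.2.1 = ((𝒢.proj w.2.1).1, (𝒢.proj w.1).1) ∧
        𝒢.proj w.2.2.2 = ((𝒢.proj w.2.1).2, (𝒢.proj w.1).2)} := by
  refine contMDiffOn_of_locally_contMDiffOn fun x hx => ?_
  obtain ⟨U, hU, hxU, σ, hσ, hpσ⟩ := 𝒢.exists_local_section (y := ((𝒢.proj x.2.1).1, (𝒢.proj x.1).2))
    (π_transition hx.1)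
  let J := 𝒢.P.I.prod (𝒢.P.I.prod (𝒢.P.I.prod 𝒢.P.I))
  have hr₂ : ContMDiff J 𝒢.P.I ∞ (fun w : 𝒢.P × 𝒢.P × 𝒢.P × 𝒢.P => w.1) := contMDiff_fst
  have hr₁ : ContMDiff J 𝒢.P.I ∞ (fun w : 𝒢.P × 𝒢.P × 𝒢.P × 𝒢.P => w.2.1) :=
    contMDiff_fst.comp contMDiff_snd
  have hp : ContMDiff J 𝒢.P.I ∞ (fun w : 𝒢.P × 𝒢.P × 𝒢.P × 𝒢.P => w.2.2.1) :=
    contMDiff_fst.comp (contMDiff_snd.comp contMDiff_snd)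
  have hp' : ContMDiff J 𝒢.P.I ∞ (fun w : 𝒢.P × 𝒢.P × 𝒢.P × 𝒢.P => w.2.2.2) :=
    contMDiff_snd.comp (contMDiff_snd.comp contMDiff_snd)
  let γ : 𝒢.P × 𝒢.P × 𝒢.P × 𝒢.P → 𝒢.Y × 𝒢.Y := fun w => (𝒢.pr₁ w.2.1, 𝒢.pr₂ w.1)
  have hγ : ContMDiff J (𝒢.Y.I.prod 𝒢.Y.I) ∞ γ :=
    (𝒢.isSmooth_pr₁.comp hr₁).prodMk (𝒢.isSmooth_pr₂.comp hr₂)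
  refine ⟨γ ⁻¹' U, hU.preimage hγ.continuous, hxU, ?_⟩
  set V : Set (𝒢.P × 𝒢.P × 𝒢.P × 𝒢.P) :=
    {w | 𝒢.proj w.2.2.1 = ((𝒢.proj w.2.1).1, (𝒢.proj w.1).1) ∧
        𝒢.proj w.2.2.2 = ((𝒢.proj w.2.1).2, (𝒢.proj w.1).2)} ∩ γ ⁻¹' U with hV
  have hσγ : ContMDiffOn J 𝒢.P.I ∞ (σ ∘ γ) V :=
    hσ.comp hγ.contMDiffOn fun w hw => ⟨hw.2, π_transition hw.1.1⟩
  have hw' : ∀ w ∈ V, 𝒢.proj (σ (γ w)) = ((𝒢.proj w.2.1).1, (𝒢.proj w.1).2) := fun w hw =>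
    hpσ _ hw.2 (π_transition hw.1.1)
  have h₁ : ContMDiffOn J (𝓡 1) ∞ (fun w => 𝒢.s w.2.2.2 (σ (γ w)) w.2.1) V :=
    𝒢.s_smooth.comp (hp'.contMDiffOn.prodMk (hσγ.prodMk hr₁.contMDiffOn)) fun w hw =>
      isTriple_right hw.1.2 (hw' w hw)
  have h₂ : ContMDiffOn J (𝓡 1) ∞ (fun w => 𝒢.s w.1 (σ (γ w)) w.2.2.1) V :=
    𝒢.s_smooth.comp (hr₂.contMDiffOn.prodMk (hσγ.prodMk hp.contMDiffOn)) fun w hw =>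
      isTriple_left hw.1.1 (hw' w hw)
  exact (h₁.mul h₂.inv).congr fun w hw => transition_eq hw.1.1 hw.1.2 (hw' w hw)

/-- The logarithmic derivatives of the two factors come from `s_flat`; both contain the term of `A`
on the velocity of the auxiliary curve `w`, and it drops out of their difference. -/
theorem hasDerivAt_transition {A : Form 𝒢.P 1 ℝ} (hA : 𝒢.IsConnection A)
    {c₂ c₁ b b' : ℝ → 𝒢.P} (hc₂ : IsCurve c₂) (hc₁ : IsCurve c₁) (hb : IsCurve b)
    (hb' : IsCurve b')
    (h : ∀ᶠ t in 𝓝 0, 𝒢.proj (b t) = ((𝒢.proj (c₁ t)).1, (𝒢.proj (c₂ t)).1) ∧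
      𝒢.proj (b' t) = ((𝒢.proj (c₁ t)).2, (𝒢.proj (c₂ t)).2)) :
    HasDerivAt (fun t : ℝ => (𝒢.transition (c₂ t) (c₁ t) (b t) (b' t) : ℂ))
      (-(Complex.I * ((-(A (c₂ 0) ![vel c₂]) + A (c₁ 0) ![vel c₁] - A (b 0) ![vel b] +
          A (b' 0) ![vel b'] : ℝ) : ℂ)) *
        (𝒢.transition (c₂ 0) (c₁ 0) (b 0) (b' 0) : ℂ)) 0 := by
  have h0 := h.self_of_nhds
  obtain ⟨U, hU, h0U, σ, hσ, hpσ⟩ := 𝒢.exists_local_section (y := ((𝒢.proj (c₁ 0)).1, (𝒢.proj (c₂ 0)).2))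
    (π_transition h0.1)
  let γ : ℝ → 𝒢.Y × 𝒢.Y := fun t => (𝒢.pr₁ (c₁ t), 𝒢.pr₂ (c₂ t))
  have hγ : ContMDiffAt 𝓘(ℝ, ℝ) (𝒢.Y.I.prod 𝒢.Y.I) ∞ γ 0 :=
    (𝒢.isSmooth_pr₁.contMDiffAt.comp 0 hc₁).prodMk (𝒢.isSmooth_pr₂.contMDiffAt.comp 0 hc₂)
  have hγU : ∀ᶠ t in 𝓝 0, γ t ∈ U := hγ.continuousAt.eventually (hU.mem_nhds h0U)
  have hw : ∀ᶠ t in 𝓝 0, 𝒢.proj (σ (γ t)) = ((𝒢.proj (c₁ t)).1, (𝒢.proj (c₂ t)).2) := by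
    filter_upwards [hγU, h] with t ht h
    exact hpσ _ ht (π_transition h.1)
  have hwc : IsCurve (σ ∘ γ) := by
    -- `σ` is smooth only within `U ∩ Y^{[2]}`, which need not be open in `Y × Y`; the composite is
    -- smooth at `0` because `γ` stays in this set near `0`.
    have hσ0 := hσ (γ 0) ⟨h0U, π_transition h0.1⟩
    refine (hσ0.comp' (s := Set.univ) 0 hγ.contMDiffWithinAt).contMDiffAt ?_
    filter_upwards [hγU, h] with t ht h using ⟨trivial, ht, π_transition h.1⟩
  have h₁ := hA.s_flat b' (σ ∘ γ) c₁ hb' hwc hc₁ (by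
    filter_upwards [h, hw] with t h hw using isTriple_right h.2 hw)
  have h₂ := hA.s_flat c₂ (σ ∘ γ) b hc₂ hwc hb (by
    filter_upwards [h, hw] with t h hw using isTriple_left h.1 hw)
  have he : (fun t : ℝ => (𝒢.transition (c₂ t) (c₁ t) (b t) (b' t) : ℂ)) =ᶠ[𝓝 0] fun t =>
      (𝒢.s (b' t) ((σ ∘ γ) t) (c₁ t) : ℂ) * (𝒢.s (c₂ t) ((σ ∘ γ) t) (b t) : ℂ)⁻¹ := by
    filter_upwards [h, hw] with t h hw
    rw [transition_eq h.1 h.2 hw, Circle.coe_mul, Circle.coe_inv]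
    rfl
  refine HasDerivAt.congr_of_eventuallyEq ?_ he
  refine (h₁.mul (h₂.fun_inv (Circle.coe_ne_zero _))).congr_deriv ?_
  rw [show (𝒢.transition (c₂ 0) (c₁ 0) (b 0) (b' 0) : ℂ) = _ from he.self_of_nhds]
  have hne := Circle.coe_ne_zero (𝒢.s (c₂ 0) ((σ ∘ γ) 0) (b 0))
  field_simp
  push_cast
  ring

end Transition

/-- Shifting a connection and curving by a 1-form on `Y` does not change the stable isomorphism
class. -/
theorem stablyIsomorphic_of_shift {𝒢 : BundleGerbe M} {C C' : 𝒢.ConnectionCurving}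
    {ε : Form 𝒢.Y 1 ℝ} (hε : ε.Smooth) (hA : C'.A = C.A - 𝒢.δ ε) (hf : C'.f = C.f - ε.d) :
    StablyIsomorphic C C' := by
  refine ⟨{
    R := 𝒢.P
    proj := 𝒢.proj
    principal := 𝒢.principal
    v := 𝒢.transition
    v_smooth := transition_smooth
    v_equivariant := fun _ _ _ _ hp hp' => transition_smul hp hp'
    δv := fun _ _ _ _ _ _ _ _ _ => transition_cocycle
    -- Only the second factor is corrected: the curvature of `C.A` is `pr₂^* f - pr₁^* f`, and it
    -- has to become `pr₂^* f' - pr₁^* f`.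
    B := C.A - Form.pullback 𝒢.pr₂ ε
    isCircleConnection := 𝒢.isCircleConnection_sub_pullback C.isConnection.isCircleConnection hε
    v_flat := fun c₂ c₁ b b' hc₂ hc₁ hb hb' h => ?_
    curvature := ?_ }⟩
  · have hd : ∀ {φ : 𝒢.P → 𝒢.Y} {c : ℝ → 𝒢.P}, IsSmooth φ → IsCurve c →
        Form.pullback φ ε (c 0) ![vel c] = ε (φ (c 0)) ![vel (fun t => φ (c t))] :=
      fun hφ hc => by
        rw [Form.pullback_apply_one, vel_comp (hφ.mdifferentiable (by simp) _)
          (hc.mdifferentiableAt (by simp))]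
    have h₁ : (fun t => 𝒢.pr₁ (b' t)) =ᶠ[𝓝 0] fun t => 𝒢.pr₂ (c₁ t) := by
      filter_upwards [h] with t ht
      have := congrArg Prod.fst ht.2
      exact this
    have h₂ : (fun t => 𝒢.pr₂ (b' t)) =ᶠ[𝓝 0] fun t => 𝒢.pr₂ (c₂ t) := by
      filter_upwards [h] with t ht
      have := congrArg Prod.snd ht.2
      exact this
    have h₁' : 𝒢.pr₁ (b' 0) = 𝒢.pr₂ (c₁ 0) := h₁.self_of_nhds
    have h₂' : 𝒢.pr₂ (b' 0) = 𝒢.pr₂ (c₂ 0) := h₂.self_of_nhds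
    -- The terms in `ε` cancel: those of `B` on `c₂` and `c₁` are opposite to those of `δε` on `b'`,
    -- because `b'` lies over the pair `(pr₂ c₁, pr₂ c₂)`.
    convert hasDerivAt_transition C.isConnection hc₂ hc₁ hb hb' h using 5
    rw [hA]
    simp only [δ, Pi.sub_apply, ContinuousAlternatingMap.sub_apply,
      hd 𝒢.isSmooth_pr₂ hc₂, hd 𝒢.isSmooth_pr₂ hc₁, hd 𝒢.isSmooth_pr₂ hb',
      hd 𝒢.isSmooth_pr₁ hb', vel_congr h₁, vel_congr h₂, h₁', h₂']
    ring
  · rw [Form.d_sub C.isConnection.isCircleConnection.smooth (hε.pullback 𝒢.isSmooth_pr₂),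
      Form.d_pullback hε 𝒢.isSmooth_pr₂, ← C.isCurving.δ_eq, hf, Form.pullback_sub]
    exact sub_right_comm _ _ _

end BundleGerbe

end GerbeReduction

end

/-! ### The proposition. -/

open GerbeReduction in
theorem mainTheorem9
    {G EG : Type*} [NormedAddCommGroup EG] [NormedSpace ℝ EG] [CompleteSpace EG]
    [TopologicalSpace G] [ChartedSpace EG G] [Group G] [LieGroup 𝓘(ℝ, EG) ∞ G]
    -- a strongly `G`-equivariant bundle gerbe with invariant connection and curving over `M`
    {M : Mfd.{u}} [MulAction G M]
    (𝒢 : BundleGerbe M) [MulAction G 𝒢.Y] [MulAction G 𝒢.P]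
    (h𝒢 : IsStronglyEquivariant G EG 𝒢)
    (C : 𝒢.ConnectionCurving) (hA : C.A.Invariant G) (hf : C.f.Invariant G)
    -- the quotient manifold `B = M / G` and the quotient gerbe over it
    {B : Mfd.{u}} (q : M → B) (hq : IsQuotient G EG q)
    (𝒢bar : BundleGerbe B) (qY : 𝒢.Y → 𝒢bar.Y) (qP : 𝒢.P → 𝒢bar.P)
    (hbar : IsQuotientGerbe G EG 𝒢 q 𝒢bar qY qP)
    -- the fixed choice of `λ`
    (lam : 𝒢.Y → (EG →L[ℝ] ℝ)) (hlam : IsAdmissible G C lam)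
    -- two connections on `M → M / G`, and the reductions that they give
    (Ξ Ξ' : Form M 1 EG) (hΞ : IsPrincipalConnection G Ξ) (hΞ' : IsPrincipalConnection G Ξ')
    (Cbar Cbar' : 𝒢bar.ConnectionCurving)
    (hC : IsReduction C lam Ξ qY qP Cbar) (hC' : IsReduction C lam Ξ' qY qP Cbar') :
    StablyIsomorphic Cbar Cbar' := by
  have := h𝒢.smooth_base
  have := h𝒢.smooth_Y
  have hκ := smooth_kappa hΞ.smooth hlam.smooth
  have hκ' := smooth_kappa hΞ'.smooth hlam.smooth
  have hlam' : ∀ (g : G) (X : EG) (y : 𝒢.Y), lam (g • y) X = lam y (Ad G g⁻¹ X) := by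
    intro g X y
    have h := hlam.ζ_eq_zero g X y
    rw [obstructionζ, mul_eq_zero, sub_eq_zero] at h
    exact h.resolve_left (by positivity)
  have hhor : ∀ (X : EG) (x : M), (Ξ' - Ξ) x ![infAct G X x] = 0 := fun X x => by
    rw [Pi.sub_apply, ContinuousAlternatingMap.sub_apply, hΞ.vertical, hΞ'.vertical, sub_self]
  have hinv : ∀ (g : G) (x : M) (w : M.model),
      Form.pullback (fun y : M => g • y) (Ξ' - Ξ) x ![w] = Ad G g ((Ξ' - Ξ) x ![w]) :=
    fun g x w => by
      rw [Form.pullback_sub, Pi.sub_apply, Pi.sub_apply, ContinuousAlternatingMap.sub_apply,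
        ContinuousAlternatingMap.sub_apply, hΞ.equivariant, hΞ'.equivariant, map_sub]
  -- The order `Ξ' - Ξ` makes the primed reduction equal to the unprimed one minus `δε` and `dε`,
  -- the sign expected by `stablyIsomorphic_of_shift`.
  obtain ⟨ε, hε, hqε⟩ := hbar.quotient_Y.exists_descent
    (smooth_kappa (hΞ'.smooth.sub hΞ.smooth) hlam.smooth)
    (kappa_invariant h𝒢.π_smul hinv hlam') (kappa_horizontal h𝒢.π_smul hhor)
  rw [kappa_sub] at hqε
  refine BundleGerbe.stablyIsomorphic_of_shift hε ?_ ?_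
  -- Upstairs on `P` the identity reads `∇ - δκ' = (∇ - δκ) - δ(κ' - κ)`; the curving is treated
  -- likewise on `Y`.
  · refine hbar.quotient_P.pullback_injective ?_
    have hqY := hbar.quotient_Y.isSmooth.mdifferentiable (by simp)
    have hqP := hbar.quotient_P.isSmooth.mdifferentiable (by simp)
    have hδ : Form.pullback qP (𝒢bar.δ ε) = 𝒢.δ (kappa Ξ' lam - kappa Ξ lam) := by
      rw [BundleGerbe.δ, Form.pullback_sub,
        Form.pullback_comp (𝒢bar.isSmooth_pr₂.mdifferentiable (by simp)) hqP,
        Form.pullback_comp (𝒢bar.isSmooth_pr₁.mdifferentiable (by simp)) hqP,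
        show 𝒢bar.pr₂ ∘ qP = qY ∘ 𝒢.pr₂ from
          funext fun p => congrArg Prod.snd (hbar.proj_comm p),
        show 𝒢bar.pr₁ ∘ qP = qY ∘ 𝒢.pr₁ from
          funext fun p => congrArg Prod.fst (hbar.proj_comm p),
        ← Form.pullback_comp hqY (𝒢.isSmooth_pr₂.mdifferentiable (by simp)),
        ← Form.pullback_comp hqY (𝒢.isSmooth_pr₁.mdifferentiable (by simp)), hqε]
      rfl
    rw [Form.pullback_sub, hδ, 𝒢.δ_sub, hC.connection, hC'.connection]
    abel
  · refine hbar.quotient_Y.pullback_injective ?_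
    rw [Form.pullback_sub, ← Form.d_pullback hε hbar.quotient_Y.isSmooth, hqε,
      Form.d_sub hκ' hκ, hC.curving, hC'.curving]
    abel
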